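/- **Setting.** Let $d=d_x+d_y$ and let $f:\mathbb R^{d_x}\times\mathbb R^{d_y}\to\mathbb R$ be twice continuously differentiable with $\rho$-Lipschitz Hessians in spectral norm ($\rho>0$), convex in $x$ and concave in $y$, with a saddle point $z^*=(x^*,y^*)$. For $z=(x,y)$ put $F(z)=(\nabla_xf(x,y),-\nabla_yf(x,y))$, with Jacobian $\nabla F$. A point $\hat z=(\hat x,\hat y)$ is an $\epsilon$-saddle point with radius $R$ (relative to the initial point $z_0=(x_0,y_0)$) if $\|\hat x-x^*\|,\|\hat y-y^*\|,\|x_0-x^*\|,\|y_0-y^*\|\le R$ and $$\max_{\|y-y^*\|\le R}f(\hat x,y)-\min_{\|x-x^*\|\le R}f(x,\hat y)\le\epsilon .$$ **Algorithm** (implementation of LEN; inputs $z_0$, $T$, $m$, $M$, search accuracy $\alpha\in(1,2]$, trial parameter $\bar\eta>0$, search length $K$). For $t=0,\dots,T-1$: 1. If $m\mid t$, compute $\nabla F(z_t)$ and a Schur decomposition $\nabla F(z_t)=QUQ^{-1}$ ($Q$ unitary, $U$ upper triangular, complex); otherwise keep the last $Q,U$. 2. Compute $F(z_t)$. For $\eta>0$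 write $z(\eta)=z_t-Q(U+\eta^{-1}I)^{-1}Q^{-1}F(z_t)$, computed by back substitution, and $\varphi(\eta)=\eta\|z(\eta)-z_t\|$. Search for $\eta_t=\gamma_t^{-1}$ with $\frac1{\alpha M}\le\varphi(\eta_t)\le\frac1M$, i.e. $M\|z(\eta_t)-z_t\|\le\gamma_t\le\alpha M\|z(\eta_t)-z_t\|$, so that $\gamma_t$ is, up to the factor $\alpha$, the root of $\gamma\mapsto M\|(QUQ^{-1}+\gamma I)^{-1}F(z_t)\|-\gamma$. Namely: let $r=\|z(\bar\eta)-z_t\|$; if $r=0$, stop and return $z(\bar\eta)$; if $\bar\eta$ is acceptable, take $\eta_t=\bar\eta$; otherwise bisect in the logarithmic scale (trial value $\sqrt{c^-c^+}$), for at most $K$ steps, starting from $[c^-,c^+]=[\bar\eta,\frac1{Mr}]$ if $\varphi(\bar\eta)<\frac1{\alpha M}$ and from $[\frac1{\alpha Mr},\bar\eta]$ if $\varphi(\bar\eta)>\frac1M$. If no acceptable value is found within $K$ steps, stop and return $z(\bar\eta)$. 3. Put $z_{t+1/2}=z(\eta_t)$ and $z_{t+1}=z_t-\gamma_t^{-1}F(z_{t+1/2})$.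 After $T$ iterations return $\big(\sum_{t<T}\gamma_t^{-1}\big)^{-1}\sum_{t<T}\gamma_t^{-1}z_{t+1/2}$. **Cost.** An evaluation of $F$ costs $N$, an evaluation of $\nabla F$ costs $Nd$, a Schur decomposition costs $\kappa d^3$, and each scalar (real or complex) arithmetic operation, square root or comparison costs $1$. **Theorem.** Let $c_1,c_2>0$ and $\kappa\in\mathbb N$. There is a constant $C>0$, depending only on $c_1,c_2,\kappa$, such that the following holds for all $d_x,d_y,N$, all $m\ge1$ with $c_1d\le m\le c_2d$, and all $\rho,D,\epsilon,\bar\eta>0$ and $\alpha\in(1,2]$. There are $T,K\in\mathbb N$ such that for every $f$ as above, every saddle point $z^*$ of $f$, every $z_0$ with $\|z_0-z^*\|\le D$ and every choice of Schur decompositions, the algorithm with $M=3\rho m$ returns an $\epsilon$-saddle point with radius $3D$, at a total cost of at most $$C\,(N+d^2)\Big(d+d^{2/3}(\rho D^3)^{2/3}\epsilon^{-2/3}\Big)\,\log\Big(2+\frac{\log\big(2+m+\rho+\rho^{-1}+D+D^{-1}+\bar\eta+\bar\eta^{-1}+\epsilon^{-1}\big)}{\log\alpha}\Big).$$ In particular,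 for fixed $\rho,D,\bar\eta,\alpha$ the computational complexity with $m=\Theta(d)$ is $\tilde{\mathcal O}\big((N+d^2)(d+d^{2/3}\epsilon^{-2/3})\big)$. -/

import Mathlib

open Matrix

noncomputable section

namespace LEN

/-! ### Minimax problems -/

/-- The Euclidean space `ℝⁿ`. -/
abbrev Vec (n : ℕ) : Type := EuclideanSpace ℝ (Fin n)

/-- The `x`-block of `z = (x, y) ∈ ℝ^{dx + dy}`. -/
def xPart {dx dy : ℕ} (z : Vec (dx + dy)) : Vec dx :=
  WithLp.toLp 2 fun i => z (Fin.castAdd dy i)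

/-- The `y`-block of `z = (x, y) ∈ ℝ^{dx + dy}`. -/
def yPart {dx dy : ℕ} (z : Vec (dx + dy)) : Vec dy :=
  WithLp.toLp 2 fun j => z (Fin.natAdd dx j)

/-- `f` as a function of the aggregated variable `z = (x, y)`. -/
def joint {dx dy : ℕ} (f : Vec dx → Vec dy → ℝ) (z : Vec (dx + dy)) : ℝ :=
  f (xPart z) (yPart z)

/-- The Hessian `∇² g (z)` as an operator; its operator norm is the spectral norm. -/
def hess {n : ℕ} (g : Vec n → ℝ) (z : Vec n) : Vec n →L[ℝ] Vec n :=
  fderiv ℝ (gradient g) z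

/-- `(xs, ys)` is a saddle point of `f`. -/
def IsSaddlePoint {dx dy : ℕ} (f : Vec dx → Vec dy → ℝ) (xs : Vec dx) (ys : Vec dy) : Prop :=
  ∀ x y, f xs y ≤ f xs ys ∧ f xs ys ≤ f x ys

/-- The convex-concave setting: `f` is twice continuously differentiable with `ρ`-Lipschitz
Hessians, convex in `x` and concave in `y`. -/
structure ConvexConcave {dx dy : ℕ} (f : Vec dx → Vec dy → ℝ) (ρ : ℝ) : Prop where
  contDiff : ContDiff ℝ 2 (joint f)
  hess_lipschitz : ∀ z z' : Vec (dx + dy),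
    ‖hess (joint f) z - hess (joint f) z'‖ ≤ ρ * ‖z - z'‖
  convex : ∀ y, ConvexOn ℝ Set.univ fun x => f x y
  concave : ∀ x, ConcaveOn ℝ Set.univ fun y => f x y

/-- The gradient descent-ascent field `F(z) = (∇ₓ f(x, y), -∇_y f(x, y))`. -/
def gdaField {dx dy : ℕ} (f : Vec dx → Vec dy → ℝ) (z : Vec (dx + dy)) : Vec (dx + dy) :=
  WithLp.toLp 2 (Fin.append
    (fun i => gradient (fun x => f x (yPart z)) (xPart z) i)
    (fun j => -gradient (fun y => f (xPart z) y) (yPart z) j))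

/-- The Jacobian matrix `∇F(z)` of a vector field. -/
def jacobian {n : ℕ} (F : Vec n → Vec n) (z : Vec n) : Matrix (Fin n) (Fin n) ℝ :=
  Matrix.of fun i j => fderiv ℝ F z (EuclideanSpace.single j 1) i

/-- The restricted gap
`max_{y ∈ B_R(ys)} f(x̂, y) - min_{x ∈ B_R(xs)} f(x, ŷ)`. -/
def gap {dx dy : ℕ} (f : Vec dx → Vec dy → ℝ) (xs : Vec dx) (ys : Vec dy) (R : ℝ)
    (xhat : Vec dx) (yhat : Vec dy) : ℝ :=
  sSup ((fun y => f xhat y) '' Metric.closedBall ys R) -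
    sInf ((fun x => f x yhat) '' Metric.closedBall xs R)

/-- `zhat` is an `ε`-saddle point, relative to the saddle point `zs`, the initial point `z₀` and
the radius `R`: the radius is large enough for the restricted gap to be meaningful at `zhat`, it
is at least the initial distance to `zs`, and the restricted gap is at most `ε`. -/
structure IsEpsSaddlePoint {dx dy : ℕ} (f : Vec dx → Vec dy → ℝ) (zs z₀ : Vec (dx + dy))
    (R ε : ℝ) (zhat : Vec (dx + dy)) : Prop where
  point_mem : max ‖xPart zhat - xPart zs‖ ‖yPart zhat - yPart zs‖ ≤ R
  start_mem : max ‖xPart z₀ - xPart zs‖ ‖yPart z₀ - yPart zs‖ ≤ R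
  gap_le : gap f (xPart zs) (yPart zs) R (xPart zhat) (yPart zhat) ≤ ε

/-! ### Computations with a cost

The result of a computation together with the number of elementary operations spent on it.
Arithmetic operations, square roots and comparisons on (real or complex) scalars cost one unit
each; memory access and loop counters are not counted. -/

structure Timed (α : Type) where
  val : α
  cost : ℕ

namespace Timed

instance : Monad Timed where
  pure a := ⟨a, 0⟩
  bind x k := ⟨(k x.val).val, x.cost + (k x.val).cost⟩

variable {𝕜 : Type} [RCLike 𝕜]

def add (a b : 𝕜) : Timed 𝕜 := ⟨a + b, 1⟩
def sub (a b : 𝕜) : Timed 𝕜 := ⟨a - b, 1⟩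
def mul (a b : 𝕜) : Timed 𝕜 := ⟨a * b, 1⟩
def div (a b : 𝕜) : Timed 𝕜 := ⟨a / b, 1⟩
def conj (a : ℂ) : Timed ℂ := ⟨star a, 1⟩
def re (a : ℂ) : Timed ℝ := ⟨a.re, 1⟩
def sqrt (a : ℝ) : Timed ℝ := ⟨Real.sqrt a, 1⟩
open Classical in
def le (a b : ℝ) : Timed Bool := ⟨decide (a ≤ b), 1⟩

/-- Compute the terms `g i`, `i ∈ s`, one after the other and accumulate them in a register that
starts at `0`: one addition per term. -/
def sum {ι : Type} (s : Finset ι) (g : ι → Timed 𝕜) : Timed 𝕜 :=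
  ⟨∑ i ∈ s, (g i).val, ∑ i ∈ s, ((g i).cost + 1)⟩

/-- Compute all entries of an array. -/
def array {n : ℕ} {β : Type} (g : Fin n → Timed β) : Timed (Fin n → β) :=
  ⟨fun i => (g i).val, ∑ i, (g i).cost⟩

/-- Compute all entries of a real vector. -/
def vec {n : ℕ} (g : Fin n → Timed ℝ) : Timed (Vec n) := do
  let a ← array g
  return WithLp.toLp 2 a

def vadd {n : ℕ} (u v : Vec n) : Timed (Vec n) := vec fun i => add (u i) (v i)
def vsub {n : ℕ} (u v : Vec n) : Timed (Vec n) := vec fun i => sub (u i) (v i)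
def vscale {n : ℕ} (c : ℝ) (v : Vec n) : Timed (Vec n) := vec fun i => mul c (v i)

/-- The Euclidean norm. -/
def vnorm {n : ℕ} (v : Vec n) : Timed ℝ := do
  let s ← sum Finset.univ fun i => mul (v i) (v i)
  sqrt s

end Timed

/-! ### Schur decomposition and triangular systems -/

/-- A routine that returns, for each real matrix `A`, a (complex) Schur decomposition
`A = Q U Q⁻¹` with `Q` unitary and `U` upper triangular. -/
structure SchurRoutine (n : ℕ) where
  Q : Matrix (Fin n) (Fin n) ℝ → Matrix (Fin n) (Fin n) ℂ
  U : Matrix (Fin n) (Fin n) ℝ → Matrix (Fin n) (Fin n) ℂ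
  unitary : ∀ A, Q A ∈ Matrix.unitaryGroup (Fin n) ℂ
  upper : ∀ A, ∀ i j, j < i → U A i j = 0
  factor : ∀ A, A.map (fun a : ℝ => (a : ℂ)) = Q A * U A * (Q A)⁻¹

/-- Every operator on a finite-dimensional complex inner product space is triangular in some
orthonormal basis. -/
theorem exists_triangular_basis (n : ℕ) : ∀ (E : Type) [NormedAddCommGroup E]
    [InnerProductSpace ℂ E] [FiniteDimensional ℂ E], Module.finrank ℂ E = n →
    ∀ T : E →ₗ[ℂ] E, ∃ b : Fin n → E, Orthonormal ℂ b ∧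
      ∀ i j, j < i → inner ℂ (b i) (T (b j)) = 0 := by
  induction n with
  | zero =>
    intro E _ _ _ _ T
    exact ⟨Fin.elim0, ⟨fun i => i.elim0, fun i => i.elim0⟩, fun i => i.elim0⟩
  | succ n ih =>
    intro E _ _ _ hE T
    have : Nontrivial E := Module.nontrivial_of_finrank_pos (R := ℂ) (by omega)
    obtain ⟨μ, hμ⟩ := Module.End.exists_eigenvalue (LinearMap.adjoint T)
    obtain ⟨v₀, hv₀⟩ := hμ.exists_hasEigenvector
    have hv0 : ‖v₀‖ ≠ 0 := norm_ne_zero_iff.mpr hv₀.2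
    set v : E := ((‖v₀‖⁻¹ : ℝ) : ℂ) • v₀ with hv
    have hvn : ‖v‖ = 1 := by
      rw [hv, norm_smul]; simp [hv0]
    have hTv : LinearMap.adjoint T v = μ • v := by
      rw [hv, map_smul, hv₀.apply_eq_smul, smul_comm]
    have hvne : v ≠ 0 := by intro h; simp [h] at hvn
    have hinv : ∀ w ∈ (ℂ ∙ v)ᗮ, T w ∈ (ℂ ∙ v)ᗮ := by
      intro w hw
      rw [Submodule.mem_orthogonal_singleton_iff_inner_right] at hw ⊢
      rw [← LinearMap.adjoint_inner_left, hTv, inner_smul_left, hw, mul_zero]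
    have hfr : Module.finrank ℂ (ℂ ∙ v)ᗮ = n := by
      have h1 := Submodule.finrank_add_finrank_orthogonal (𝕜 := ℂ) (ℂ ∙ v)
      rw [finrank_span_singleton hvne, hE] at h1
      omega
    obtain ⟨b, hb, hbT⟩ := ih (ℂ ∙ v)ᗮ hfr (T.restrict hinv)
    have hvb : ∀ i, inner ℂ v (b i : E) = 0 := fun i =>
      (Submodule.mem_orthogonal_singleton_iff_inner_right).mp (b i).2
    refine ⟨Fin.snoc (fun i => (b i : E)) v, ?_, ?_⟩
    · rw [orthonormal_iff_ite] at hb ⊢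
      intro i j
      refine Fin.lastCases ?_ (fun i => ?_) i <;> refine Fin.lastCases ?_ (fun j => ?_) j
      · simp [hvn]
      · simp [hvb, (Fin.castSucc_lt_last j).ne']
      · have := inner_eq_zero_symm.mp (hvb i)
        simp [this, (Fin.castSucc_lt_last i).ne]
      · have := hb i j
        simpa using this
    · intro i j hij
      induction j using Fin.lastCases with
      | last => exact absurd hij (not_lt.mpr (Fin.le_last i))
      | cast j =>
        induction i using Fin.lastCases with
        | last =>
          simp only [Fin.snoc_last, Fin.snoc_castSucc]
          rw [← LinearMap.adjoint_inner_left, hTv, inner_smul_left, hvb, mul_zero]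
        | cast i =>
          have := hbT i j (by simpa using hij)
          simpa using this

theorem exists_schur {n : ℕ} (A : Matrix (Fin n) (Fin n) ℂ) :
    ∃ Q U : Matrix (Fin n) (Fin n) ℂ, Q ∈ Matrix.unitaryGroup (Fin n) ℂ ∧
      (∀ i j, j < i → U i j = 0) ∧ A = Q * U * Q⁻¹ := by
  obtain ⟨b, hb, hT⟩ := exists_triangular_basis n (EuclideanSpace ℂ (Fin n)) (by simp)
    (Matrix.toEuclideanLin A)
  let Q : Matrix (Fin n) (Fin n) ℂ := Matrix.of fun i j => b j i
  have hQ : Qᴴ * Q = 1 := by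
    ext i j
    have := (orthonormal_iff_ite.mp hb) i j
    rw [Matrix.mul_apply, Matrix.one_apply, ← this, PiLp.inner_apply]
    simp [Q, mul_comm]
  have hQ' : Q * Qᴴ = 1 := mul_eq_one_comm.mp hQ
  have hinv : Q⁻¹ = Qᴴ := Matrix.inv_eq_left_inv hQ
  refine ⟨Q, Qᴴ * A * Q, (Matrix.mem_unitaryGroup_iff).mpr hQ', ?_, ?_⟩
  · intro i j hij
    rw [← hT i j hij, PiLp.inner_apply, Matrix.mul_assoc, Matrix.mul_apply]
    refine Finset.sum_congr rfl fun k _ => ?_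
    simp [Q, Matrix.mul_apply, Matrix.toLpLin_apply, Matrix.mulVec, dotProduct, mul_comm]
  · rw [hinv]
    calc A = (Q * Qᴴ) * A * (Q * Qᴴ) := by rw [hQ']; simp
      _ = _ := by simp only [Matrix.mul_assoc]

/-- Schur decomposition routines exist. -/
instance (n : ℕ) : Nonempty (SchurRoutine n) := by
  choose Q U h using fun A : Matrix (Fin n) (Fin n) ℝ =>
    exists_schur (A.map (fun a : ℝ => (a : ℂ)))
  exact ⟨⟨Q, U, fun A => (h A).1, fun A => (h A).2.1, fun A => (h A).2.2⟩⟩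

/-- What the algorithm may call: the oracles for `F` (cost `N`) and `∇F` (cost `N n`), and a Schur
decomposition routine (cost `κ n³`). -/
structure Machine (n : ℕ) where
  F : Vec n → Vec n
  N : ℕ
  schur : SchurRoutine n
  κ : ℕ

namespace Machine

variable {n : ℕ} (P : Machine n)

def evalF (z : Vec n) : Timed (Vec n) := ⟨P.F z, P.N⟩

def evalJacobian (z : Vec n) : Timed (Matrix (Fin n) (Fin n) ℝ) :=
  ⟨jacobian P.F z, P.N * n⟩

def evalSchur (A : Matrix (Fin n) (Fin n) ℝ) :
    Timed (Matrix (Fin n) (Fin n) ℂ × Matrix (Fin n) (Fin n) ℂ) :=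
  ⟨(P.schur.Q A, P.schur.U A), P.κ * n ^ 3⟩

end Machine

/-- Back substitution for `(U + γ I) w = b` with `U` upper triangular, from the last row to the
first: `wᵢ = (bᵢ - ∑_{j > i} Uᵢⱼ wⱼ) / (Uᵢᵢ + γ)`. -/
def backSubst {n : ℕ} (U : Matrix (Fin n) (Fin n) ℂ) (γ : ℝ) (b : Fin n → ℂ) :
    Timed (Fin n → ℂ) :=
  (List.finRange n).reverse.foldlM (init := fun _ => 0) fun w i => do
    let s ← Timed.sum (Finset.Ioi i) fun j => Timed.mul (U i j) (w j)
    let num ← Timed.sub (b i) s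
    let den ← Timed.add (U i i) (γ : ℂ)
    let wi ← Timed.div num den
    return Function.update w i wi

/-- The regularized Newton step `z - Q (U + η⁻¹ I)⁻¹ Q⁻¹ Fz`, where `Q⁻¹ = Qᴴ`. -/
def newtonStep {n : ℕ} (Q U : Matrix (Fin n) (Fin n) ℂ) (z Fz : Vec n) (η : ℝ) :
    Timed (Vec n) := do
  let γ ← Timed.div 1 η
  let b ← Timed.array fun i => Timed.sum Finset.univ fun j => do
    let q ← Timed.conj (Q j i)
    Timed.mul q (Fz j : ℂ)
  let w ← backSubst U γ b
  let h ← Timed.vec fun i => do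
    let s ← Timed.sum Finset.univ fun j => Timed.mul (Q i j) (w j)
    Timed.re s
  Timed.vsub z h

/-! ### The search for the regularization parameter

With `zhalf(η)` the Newton step with parameter `γ = 1 / η`, the search looks for `η > 0` with
`1 / (α M) ≤ η ‖zhalf(η) - z‖ ≤ 1 / M`, that is, `M ‖zhalf - z‖ ≤ γ ≤ α M ‖zhalf - z‖`: up to the
factor `α > 1`, `γ` is the root of `γ ↦ M ‖(∇F + γ I)⁻¹ F(z)‖ - γ`. -/

/-- At most `K` steps of bisection, in the logarithmic scale, on the bracket `[lo, hi]`. -/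
def bisect {n : ℕ} (Q U : Matrix (Fin n) (Fin n) ℂ) (z Fz : Vec n) (M α : ℝ) :
    ℕ → ℝ → ℝ → Timed (Option (ℝ × Vec n))
  | 0, _, _ => return none
  | K + 1, lo, hi => do
    let p ← Timed.mul lo hi
    let η ← Timed.sqrt p
    let zhalf ← newtonStep Q U z Fz η
    let v ← Timed.vsub zhalf z
    let r ← Timed.vnorm v
    let φ ← Timed.mul η r
    let upper ← Timed.div 1 M
    let αM ← Timed.mul α M
    let lower ← Timed.div 1 αM
    let small ← Timed.le φ upper
    if small then
      let large ← Timed.le lower φ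
      if large then
        return some (η, zhalf)
      else
        bisect Q U z Fz M α K η hi
    else
      bisect Q U z Fz M α K lo η

/-- The outcome of the search: an acceptable pair `(η, zhalf)`, or a point at which the whole
algorithm stops. -/
inductive SearchResult (n : ℕ) : Type
  | found (η : ℝ) (zhalf : Vec n)
  | halt (zhat : Vec n)

/-- Bracketing from the trial parameter `η₀`, followed by at most `K` steps of bisection. If the
trial Newton step does not move, or if the bisection is not successful within `K` steps, the
trial Newton point is reported as the final answer. -/
def search {n : ℕ} (Q U : Matrix (Fin n) (Fin n) ℂ) (z Fz : Vec n) (M α η₀ : ℝ) (K : ℕ) :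
    Timed (SearchResult n) := do
  let ztrial ← newtonStep Q U z Fz η₀
  let v ← Timed.vsub ztrial z
  let r ← Timed.vnorm v
  let stationary ← Timed.le r 0
  if stationary then
    return .halt ztrial
  else
    let φ ← Timed.mul η₀ r
    let upper ← Timed.div 1 M
    let αM ← Timed.mul α M
    let lower ← Timed.div 1 αM
    let small ← Timed.le φ upper
    let large ← Timed.le lower φ
    if small && large then
      return .found η₀ ztrial
    else
      let Mr ← Timed.mul M r
      let αMr ← Timed.mul αM r
      let hi ← Timed.div 1 Mr
      let lo ← Timed.div 1 αMr
      let res ← if small then bisect Q U z Fz M α K η₀ hi else bisect Q U z Fz M α K lo η₀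
      match res with
      | some (η, zhalf) => return .found η zhalf
      | none => return .halt ztrial

/-! ### The algorithm -/

/-- The state at the beginning of an iteration: the iterate `z_t`, the Schur factors computed at
the last snapshot, and the sums `∑ γ_s⁻¹` and `∑ γ_s⁻¹ z_{s+1/2}` over the past iterations. -/
structure State (n : ℕ) where
  z : Vec n
  Q : Matrix (Fin n) (Fin n) ℂ
  U : Matrix (Fin n) (Fin n) ℂ
  weight : ℝ
  total : Vec n

/-- The iterations `t, t + 1, …, t + k - 1`, followed by the output of the weighted average. -/
def lenLoop {n : ℕ} (P : Machine n) (m : ℕ) (M α η₀ : ℝ) (K : ℕ) :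
    ℕ → ℕ → State n → Timed (Vec n)
  | 0, _, s => do
    let c ← Timed.div 1 s.weight
    Timed.vscale c s.total
  | k + 1, t, s => do
    let QU ← (if t % m = 0 then do
        let J ← P.evalJacobian s.z
        P.evalSchur J
      else
        return (s.Q, s.U) :
      Timed (Matrix (Fin n) (Fin n) ℂ × Matrix (Fin n) (Fin n) ℂ))
    let Fz ← P.evalF s.z
    let res ← search QU.1 QU.2 s.z Fz M α η₀ K
    match res with
    | .halt zhat => return zhat
    | .found η zhalf => do
      let Fhalf ← P.evalF zhalf
      let step ← Timed.vscale η Fhalf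
      let znext ← Timed.vsub s.z step
      let weight ← Timed.add s.weight η
      let wz ← Timed.vscale η zhalf
      let total ← Timed.vadd s.total wz
      lenLoop P m M α η₀ K k (t + 1) ⟨znext, QU.1, QU.2, weight, total⟩

/-- The implementation of LEN with `T` iterations, a Schur decomposition every `m` iterations,
regularization `M`, search accuracy `α`, trial parameter `η₀` and at most `K` bisection steps
per search. -/
def len {n : ℕ} (P : Machine n) (z₀ : Vec n) (T m : ℕ) (M α η₀ : ℝ) (K : ℕ) : Timed (Vec n) :=
  lenLoop P m M α η₀ K T 0 ⟨z₀, 0, 0, 0, 0⟩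

/-- The logarithmic factor in the complexity bound. -/
def logFactor (m : ℕ) (ρ D ε η₀ α : ℝ) : ℝ :=
  Real.log (2 + Real.log (2 + m + ρ + ρ⁻¹ + D + D⁻¹ + η₀ + η₀⁻¹ + ε⁻¹) / Real.log α)

end LEN

end

/-! The field F = `gdaField f` is monotone with ρ-Lipschitz derivative, and the gap at w against (x,
y) is at most ⟪F w, w - (x, y)⟫. So it suffices that the weighted sum of these inner products is
small compared with the total weight.

Put r_t = ‖z_{t+1/2} - z_t‖ and e_t = ‖z_{t+1} - z_{t+1/2}‖. The weighted regret obeys an exact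
identity containing -∑ r_t² + ∑ e_t² (`IsRun.sum_inner_eq`). By the Newton equation, e_t is η_t
times the error of linearizing F with the stale Jacobian, and η_t r_t ≤ 1/(3ρm) turns this into e_t
≤ (r_t + distance to the snapshot)/(3m). A snapshot is fewer than m steps old, so Cauchy–Schwarz
over an epoch gives ∑ e_t² ≤ (4/7) ∑ r_t² (`sum_sq_le_of_epoch`). Hence the iterates stay within D
of the saddle point and ∑ r_t² ≤ (7/3) D². As η_t ≥ 1/(6ρm r_t), convexity forces ∑ η_t ≥
T^(3/2)/(12ρmD), while the regret is at most 18 D². So T of order (ρmD³/ε)^(2/3) suffices.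

The number of bisection steps must not depend on f, although neither F nor its derivative is bounded
in terms of ρ and D. By monotonicity the Newton step grows with η, but at most linearly
(`norm_newtonStep_mono`), so φ grows at most quadratically. The target window has ratio α, so a
valid bracket always has (hi/lo)² ≥ α, while each bisection halves log (hi/lo). Failure therefore
means that the initial bracket was enormous. Since F vanishes at the saddle point, the trial step is
at most 2D + 3ρD²η₀, which excludes this on one side. On the other side the trial step is so short
that the trial point is itself an ε-saddle point, so halting there is correct.

Each iteration costs 2N and at most K + 1 Newton steps of O(d²) operations. The ⌈T/m⌉ snapshots cost
Nd + κd³ each, and m ≥ c₁d amortizes this to O((T + d)(N + d²)). -/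

namespace LEN

/-! ### Values and costs of the elementary operations -/

namespace Timed

@[simp] theorem val_pure {α : Type} (a : α) : (pure a : Timed α).val = a := rfl
@[simp] theorem cost_pure {α : Type} (a : α) : (pure a : Timed α).cost = 0 := rfl
@[simp] theorem val_bind {α β : Type} (x : Timed α) (k : α → Timed β) :
    (x >>= k).val = (k x.val).val := rfl
@[simp] theorem cost_bind {α β : Type} (x : Timed α) (k : α → Timed β) :
    (x >>= k).cost = x.cost + (k x.val).cost := rfl

variable {𝕜 : Type} [RCLike 𝕜]

@[simp] theorem val_add (a b : 𝕜) : (add a b).val = a + b := rfl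
@[simp] theorem cost_add (a b : 𝕜) : (add a b).cost = 1 := rfl
@[simp] theorem val_sub (a b : 𝕜) : (sub a b).val = a - b := rfl
@[simp] theorem cost_sub (a b : 𝕜) : (sub a b).cost = 1 := rfl
@[simp] theorem val_mul (a b : 𝕜) : (mul a b).val = a * b := rfl
@[simp] theorem cost_mul (a b : 𝕜) : (mul a b).cost = 1 := rfl
@[simp] theorem val_div (a b : 𝕜) : (div a b).val = a / b := rfl
@[simp] theorem cost_div (a b : 𝕜) : (div a b).cost = 1 := rfl
@[simp] theorem val_conj (a : ℂ) : (conj a).val = star a := rfl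
@[simp] theorem cost_conj (a : ℂ) : (conj a).cost = 1 := rfl
@[simp] theorem val_re (a : ℂ) : (re a).val = a.re := rfl
@[simp] theorem cost_re (a : ℂ) : (re a).cost = 1 := rfl
@[simp] theorem val_sqrt (a : ℝ) : (sqrt a).val = Real.sqrt a := rfl
@[simp] theorem cost_sqrt (a : ℝ) : (sqrt a).cost = 1 := rfl
@[simp] theorem val_le (a b : ℝ) : ((le a b).val = true) ↔ a ≤ b := by simp [le]
@[simp] theorem cost_le (a b : ℝ) : (le a b).cost = 1 := rfl
@[simp] theorem val_sum {ι : Type} (s : Finset ι) (g : ι → Timed 𝕜) :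
    (sum s g).val = ∑ i ∈ s, (g i).val := rfl
@[simp] theorem cost_sum {ι : Type} (s : Finset ι) (g : ι → Timed 𝕜) :
    (sum s g).cost = ∑ i ∈ s, ((g i).cost + 1) := rfl
@[simp] theorem val_array {n : ℕ} {β : Type} (g : Fin n → Timed β) (i : Fin n) :
    (array g).val i = (g i).val := rfl
@[simp] theorem cost_array {n : ℕ} {β : Type} (g : Fin n → Timed β) :
    (array g).cost = ∑ i, (g i).cost := rfl
@[simp] theorem val_vec {n : ℕ} (g : Fin n → Timed ℝ) (i : Fin n) :
    (vec g).val i = (g i).val := rfl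
@[simp] theorem cost_vec {n : ℕ} (g : Fin n → Timed ℝ) :
    (vec g).cost = ∑ i, (g i).cost := by simp [vec]
@[simp] theorem val_vadd {n : ℕ} (u v : Vec n) : (vadd u v).val = u + v := by
  ext i; simp [vadd]
@[simp] theorem cost_vadd {n : ℕ} (u v : Vec n) : (vadd u v).cost = n := by simp [vadd]
@[simp] theorem val_vsub {n : ℕ} (u v : Vec n) : (vsub u v).val = u - v := by
  ext i; simp [vsub]
@[simp] theorem cost_vsub {n : ℕ} (u v : Vec n) : (vsub u v).cost = n := by simp [vsub]
@[simp] theorem val_vscale {n : ℕ} (c : ℝ) (v : Vec n) : (vscale c v).val = c • v := by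
  ext i; simp [vscale]
@[simp] theorem cost_vscale {n : ℕ} (c : ℝ) (v : Vec n) : (vscale c v).cost = n := by
  simp [vscale]
@[simp] theorem val_vnorm {n : ℕ} (v : Vec n) : (vnorm v).val = ‖v‖ := by
  simp [vnorm, EuclideanSpace.norm_eq, sq]
@[simp] theorem cost_vnorm {n : ℕ} (v : Vec n) : (vnorm v).cost = 2 * n + 1 := by
  simp [vnorm, mul_comm]

theorem val_foldlM {α β : Type} (f : β → α → Timed β) (l : List α) (b : β) :
    (l.foldlM f b).val = l.foldl (fun w i => (f w i).val) b := by
  induction l generalizing b with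
  | nil => rfl
  | cons a l ih => simp [List.foldlM_cons, ih]

theorem cost_foldlM_le {α β : Type} (f : β → α → Timed β) {c : ℕ} (hf : ∀ b a, (f b a).cost ≤ c)
    (l : List α) (b : β) : (l.foldlM f b).cost ≤ l.length * c := by
  induction l generalizing b with
  | nil => simp
  | cons a l ih =>
    have h1 := hf b a
    have h2 := ih (f b a).val
    simp only [List.foldlM_cons, cost_bind, List.length_cons, Nat.succ_mul]
    omega

end Timed

/-! ### Triangular systems and the regularized Newton step -/

section BackSubstitution

variable {n : ℕ} (U : Matrix (Fin n) (Fin n) ℂ) (γ : ℝ) (b : Fin n → ℂ)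

theorem backSubst_val : (backSubst U γ b).val =
    (List.finRange n).foldr (fun i w => Function.update w i
      ((b i - ∑ j ∈ Finset.Ioi i, U i j * w j) / (U i i + γ))) (fun _ => 0) := by
  rw [backSubst, Timed.val_foldlM, List.foldl_reverse]
  rfl

/-- Entry i is written once, after all entries with larger index, and every later update touches a
smaller index. So the row equation that holds at the time of writing survives to the end. The
induction runs over increasing lists, since the fold over the reversed list is a `foldr`. -/
theorem backSubst_apply (i : Fin n) : (backSubst U γ b).val i =
    (b i - ∑ j ∈ Finset.Ioi i, U i j * (backSubst U γ b).val j) / (U i i + γ) := by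
  rw [backSubst_val]
  have key : ∀ l : List (Fin n), l.Pairwise (· < ·) → ∀ i ∈ l,
      let w := l.foldr (fun i w => Function.update w i
        ((b i - ∑ j ∈ Finset.Ioi i, U i j * w j) / (U i i + γ))) (fun _ => 0)
      w i = (b i - ∑ j ∈ Finset.Ioi i, U i j * w j) / (U i i + γ) := by
    intro l hl
    induction l with
    | nil => simp
    | cons a l ih =>
      rw [List.pairwise_cons] at hl
      intro i hi
      simp only [List.foldr_cons]
      set w := l.foldr (fun i w => Function.update w i
        ((b i - ∑ j ∈ Finset.Ioi i, U i j * w j) / (U i i + γ))) (fun _ => 0) with hw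
      have hsum : ∀ k, a ≤ k → ∀ x, ∑ j ∈ Finset.Ioi k, U k j * Function.update w a x j =
          ∑ j ∈ Finset.Ioi k, U k j * w j := by
        intro k hk x
        refine Finset.sum_congr rfl fun j hj => ?_
        rw [Function.update_of_ne (hk.trans_lt (Finset.mem_Ioi.mp hj)).ne']
      rcases List.mem_cons.mp hi with rfl | hi
      · rw [Function.update_self, hsum _ le_rfl]
      · rw [Function.update_of_ne (hl.1 i hi).ne', hsum _ (hl.1 i hi).le]
        exact ih hl.2 i hi
  exact key _ (List.pairwise_lt_finRange n) i (List.mem_finRange i)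

theorem backSubst_cost_le : (backSubst U γ b).cost ≤ n * (2 * n + 3) := by
  refine (Timed.cost_foldlM_le _ (c := 2 * n + 3) ?_ _ _).trans_eq (by simp)
  intro w i
  have : (Finset.Ioi i).card ≤ n := (Finset.card_le_univ _).trans_eq (by simp)
  simp only [Timed.cost_bind, Timed.cost_sum, Timed.cost_mul, Timed.cost_sub, Timed.cost_add,
    Timed.cost_div, Timed.cost_pure, Finset.sum_const, smul_eq_mul]
  omega

/-- Back substitution solves the triangular system. -/
theorem backSubst_solves (hU : ∀ i j, j < i → U i j = 0) (hd : ∀ i, U i i + γ ≠ 0) :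
    (U + (γ : ℂ) • (1 : Matrix (Fin n) (Fin n) ℂ)) *ᵥ (backSubst U γ b).val = b := by
  ext i
  have h := backSubst_apply U γ b i
  rw [eq_div_iff (hd i)] at h
  set w := (backSubst U γ b).val
  have hs : ∑ j, U i j * w j = U i i * w i + ∑ j ∈ Finset.Ioi i, U i j * w j := by
    rw [← Finset.sum_subset (Finset.subset_univ (Finset.Ici i)), ← Finset.Ioi_insert,
      Finset.sum_insert (by simp)]
    intro j _ hj
    rw [hU i j (by simpa using hj), zero_mul]
  rw [Matrix.add_mulVec, Matrix.smul_mulVec, Matrix.one_mulVec, Pi.add_apply, Matrix.mulVec,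
    dotProduct, hs, Pi.smul_apply, smul_eq_mul]
  linear_combination h

end BackSubstitution

/-- The diagonal of a shifted Schur factor does not vanish when the shifted matrix is regular. -/
theorem SchurRoutine.diag_ne_zero {n : ℕ} (S : SchurRoutine n) (A : Matrix (Fin n) (Fin n) ℝ)
    (γ : ℝ) (hdet : (A + γ • (1 : Matrix (Fin n) (Fin n) ℝ)).det ≠ 0) (i : Fin n) :
    S.U A i i + γ ≠ 0 := by
  have hQ : IsUnit (S.Q A).det := by
    have := (Matrix.mem_unitaryGroup_iff).mp (S.unitary A)
    exact Matrix.isUnit_det_of_right_inverse this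
  have h1 : (A + γ • (1 : Matrix (Fin n) (Fin n) ℝ)).map (fun a : ℝ => (a : ℂ)) =
      S.Q A * (S.U A + (γ : ℂ) • (1 : Matrix (Fin n) (Fin n) ℂ)) * (S.Q A)⁻¹ := by
    rw [mul_add, add_mul, ← S.factor A, Matrix.mul_smul, Matrix.mul_one, Matrix.smul_mul,
      Matrix.mul_nonsing_inv _ hQ]
    ext i j
    by_cases hij : i = j <;> simp [hij]
  have h2 : ((A + γ • (1 : Matrix (Fin n) (Fin n) ℝ)).map (fun a : ℝ => (a : ℂ))).det ≠ 0 := by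
    have := RingHom.map_det Complex.ofRealHom (A + γ • (1 : Matrix (Fin n) (Fin n) ℝ))
    rw [RingHom.mapMatrix_apply] at this
    change (Matrix.map _ Complex.ofRealHom).det ≠ 0
    rw [← this]
    simpa using hdet
  have h3 : (S.U A + (γ : ℂ) • (1 : Matrix (Fin n) (Fin n) ℂ)).det ≠ 0 := by
    intro h
    apply h2
    rw [h1, Matrix.det_mul, Matrix.det_mul, h]
    simp
  rw [Matrix.det_of_isUpperTriangular] at h3
  · have := Finset.prod_ne_zero_iff.mp h3 i (Finset.mem_univ i)
    simpa using this
  · intro i j hij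
    have hij' : j < i := hij
    simp [S.upper A i j hij', hij'.ne']

/-- The regularized Newton step subtracts the solution of the regularized linear system. -/
theorem newtonStep_val {n : ℕ} (S : SchurRoutine n) (A : Matrix (Fin n) (Fin n) ℝ)
    (z Fz : Vec n) (η : ℝ) (hdet : (A + (1 / η) • (1 : Matrix (Fin n) (Fin n) ℝ)).det ≠ 0) :
    (A + (1 / η) • (1 : Matrix (Fin n) (Fin n) ℝ)) *ᵥ
      (z - (newtonStep (S.Q A) (S.U A) z Fz η).val).ofLp = Fz.ofLp := by
  set γ : ℝ := 1 / η with hγ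
  set Q := S.Q A with hQdef
  set U := S.U A
  set b : Fin n → ℂ := Qᴴ *ᵥ (fun j => (Fz j : ℂ)) with hb
  set w := (backSubst U γ b).val with hw
  have hQ : Q * Qᴴ = 1 := (Matrix.mem_unitaryGroup_iff).mp (S.unitary A)
  have hinv : Q⁻¹ = Qᴴ := Matrix.inv_eq_right_inv hQ
  have hsol := backSubst_solves U γ b (S.upper A) (S.diag_ne_zero A γ hdet)
  have hval : z - (newtonStep Q U z Fz η).val = WithLp.toLp 2 fun i => ((Q *ᵥ w) i).re := by
    have hbb : (Timed.array fun i => Timed.sum Finset.univ fun j => do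
        let q ← Timed.conj (Q j i)
        Timed.mul q (Fz j : ℂ)).val = b := by
      ext i
      simp [hb, Matrix.mulVec, dotProduct]
    ext i
    simp only [newtonStep, Timed.val_bind, Timed.val_vsub, sub_sub_cancel]
    rw [hbb]
    simp [Matrix.mulVec, dotProduct, hw, hγ]
  have hC : (A + γ • (1 : Matrix (Fin n) (Fin n) ℝ)).map (fun a : ℝ => (a : ℂ)) *ᵥ (Q *ᵥ w) =
      fun j => (Fz j : ℂ) := by
    have h1 : (A + γ • (1 : Matrix (Fin n) (Fin n) ℝ)).map (fun a : ℝ => (a : ℂ)) =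
        Q * (U + (γ : ℂ) • (1 : Matrix (Fin n) (Fin n) ℂ)) * Qᴴ := by
      rw [mul_add, add_mul, ← hinv, ← S.factor A, Matrix.mul_smul, Matrix.mul_one,
        Matrix.smul_mul, hinv, hQ]
      ext i j
      by_cases hij : i = j <;> simp [hij]
    rw [h1, Matrix.mulVec_mulVec, Matrix.mul_assoc, mul_eq_one_comm.mp hQ, Matrix.mul_one,
      ← Matrix.mulVec_mulVec, hsol, hb, Matrix.mulVec_mulVec, hQ, Matrix.one_mulVec]
  rw [hval]
  ext i
  -- The shifted matrix and the right-hand side are real, so the real part of the complex solution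
  -- is again a solution. Its imaginary part need not be shown to vanish.
  have := congrArg Complex.re (congrFun hC i)
  simpa [Matrix.mulVec, dotProduct] using this

/-! ### Operation counts for the Newton step and the search -/

theorem newtonStep_cost_le {n : ℕ} (hn : 0 < n) (Q U : Matrix (Fin n) (Fin n) ℂ) (z Fz : Vec n)
    (η : ℝ) : (newtonStep Q U z Fz η).cost ≤ 13 * n ^ 2 := by
  have h := fun b => backSubst_cost_le U (1 / η) b
  simp only [newtonStep, Timed.cost_bind, Timed.cost_div, Timed.val_div, Timed.cost_array,
    Timed.cost_sum, Timed.cost_conj, Timed.cost_mul, Timed.cost_vec, Timed.cost_re,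
    Timed.cost_vsub, Finset.sum_const, Finset.card_univ, Fintype.card_fin, smul_eq_mul]
  -- The total is at most 7n² + 5n + 1, and 7 + 5 + 1 = 13 because n ≥ 1. The constants 26 and 28
  -- below arise in the same way.
  refine (Nat.add_le_add_left (Nat.add_le_add_left (Nat.add_le_add_right (h _) _) _) _).trans ?_
  nlinarith

theorem bisect_cost_le {n : ℕ} (hn : 0 < n) (Q U : Matrix (Fin n) (Fin n) ℂ) (z Fz : Vec n)
    (M α : ℝ) (K : ℕ) (lo hi : ℝ) :
    (bisect Q U z Fz M α K lo hi).cost ≤ K * (26 * n ^ 2) := by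
  induction K generalizing lo hi with
  | zero => simp [bisect]
  | succ K ih =>
    have h := fun η => newtonStep_cost_le hn Q U z Fz η
    have hstep : ∀ x y : ℕ, x ≤ 13 * n ^ 2 → y ≤ K * (26 * n ^ 2) →
        x + y + 3 * n + 10 ≤ (K + 1) * (26 * n ^ 2) := by
      intro x y hx hy
      nlinarith
    simp only [bisect, Timed.cost_bind, Timed.cost_mul, Timed.val_mul, Timed.cost_sqrt,
      Timed.val_sqrt, Timed.cost_vsub, Timed.cost_vnorm, Timed.cost_div, Timed.cost_le]
    split_ifs
    · simp only [Timed.cost_bind, Timed.cost_le]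
      split_ifs
      · have := hstep _ 0 (h √(lo * hi)) (Nat.zero_le _)
        simp only [Timed.cost_pure]
        omega
      · have := hstep _ _ (h √(lo * hi)) (ih √(lo * hi) hi)
        omega
    · have := hstep _ _ (h √(lo * hi)) (ih lo √(lo * hi))
      omega

theorem search_cost_le {n : ℕ} (hn : 0 < n) (Q U : Matrix (Fin n) (Fin n) ℂ) (z Fz : Vec n)
    (M α η₀ : ℝ) (K : ℕ) :
    (search Q U z Fz M α η₀ K).cost ≤ (K + 1) * (28 * n ^ 2) := by
  have h := newtonStep_cost_le hn Q U z Fz η₀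
  have hb := fun lo hi => bisect_cost_le hn Q U z Fz M α K lo hi
  have hstep : ∀ x y : ℕ, x ≤ 13 * n ^ 2 → y ≤ K * (26 * n ^ 2) →
      x + y + 3 * n + 12 ≤ (K + 1) * (28 * n ^ 2) := by
    intro x y hx hy
    nlinarith
  simp only [search, Timed.cost_bind, Timed.cost_vsub, Timed.cost_vnorm, Timed.cost_le]
  split_ifs
  · have := hstep _ 0 h (Nat.zero_le _)
    simp only [Timed.cost_pure]
    omega
  · simp only [Timed.cost_bind, Timed.cost_mul, Timed.cost_div, Timed.cost_le]
    split_ifs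
    · have := hstep _ 0 h (Nat.zero_le _)
      simp only [Timed.cost_pure]
      omega
    · have := hstep _ _ h (hb η₀ (1 / (M * ‖(newtonStep Q U z Fz η₀).val - z‖)))
      simp only [Timed.cost_bind, Timed.cost_mul, Timed.cost_div, Timed.val_div, Timed.val_mul,
        Timed.val_vnorm, Timed.val_vsub]
      generalize bisect Q U z Fz M α K
        η₀ (1 / (M * ‖(newtonStep Q U z Fz η₀).val - z‖)) = B at this ⊢
      generalize (newtonStep Q U z Fz η₀).cost = c at this ⊢
      rcases B with ⟨_ | ⟨_, _⟩, c'⟩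
      all_goals
        simp only [Timed.cost_pure] at this ⊢
        omega
    · have := hstep _ _ h (hb (1 / (α * M * ‖(newtonStep Q U z Fz η₀).val - z‖)) η₀)
      simp only [Timed.cost_bind, Timed.cost_mul, Timed.cost_div, Timed.val_div, Timed.val_mul,
        Timed.val_vnorm, Timed.val_vsub]
      generalize bisect Q U z Fz M α K
        (1 / (α * M * ‖(newtonStep Q U z Fz η₀).val - z‖)) η₀ = B at this ⊢
      generalize (newtonStep Q U z Fz η₀).cost = c at this ⊢
      rcases B with ⟨_ | ⟨_, _⟩, c'⟩
      all_goals
        simp only [Timed.cost_pure] at this ⊢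
        omega

/-! ### Convex-concave functions and their gradient descent-ascent field -/

open scoped RealInnerProductSpace

/-- First-order characterization of convexity. -/
theorem _root_.ConvexOn.add_fderiv_le {E : Type*} [NormedAddCommGroup E] [NormedSpace ℝ E]
    {g : E → ℝ} (hg : ConvexOn ℝ Set.univ g) {x : E} {g' : E →L[ℝ] ℝ} (hx : HasFDerivAt g g' x)
    (y : E) : g x + g' (y - x) ≤ g y := by
  have h1 : ConvexOn ℝ Set.univ (g ∘ AffineMap.lineMap (k := ℝ) x y) := by
    simpa using hg.comp_affineMap (AffineMap.lineMap (k := ℝ) x y)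
  have h2 : HasDerivAt (g ∘ AffineMap.lineMap (k := ℝ) x y) (g' (y - x)) 0 := by
    refine HasFDerivAt.comp_hasDerivAt (0 : ℝ) ?_ AffineMap.hasDerivAt_lineMap
    simpa using hx
  have h3 := h1.le_slope_of_hasDerivAt (Set.mem_univ 0) (Set.mem_univ 1) zero_lt_one h2
  simp [slope_def_field] at h3
  rw [map_sub]
  linarith

section Blocks

variable {dx dy : ℕ}

/-- The point `(x, y)`. -/
noncomputable def join (x : Vec dx) (y : Vec dy) : Vec (dx + dy) := WithLp.toLp 2 (Fin.append x y)

@[simp] theorem xPart_join (x : Vec dx) (y : Vec dy) : xPart (join x y) = x := by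
  ext i; simp [xPart, join]

@[simp] theorem yPart_join (x : Vec dx) (y : Vec dy) : yPart (join x y) = y := by
  ext i; simp [yPart, join]

@[simp] theorem join_xPart_yPart (z : Vec (dx + dy)) : join (xPart z) (yPart z) = z := by
  ext i
  refine Fin.addCases (fun i => ?_) (fun i => ?_) i <;> simp [xPart, yPart, join]

@[simp] theorem xPart_sub (z w : Vec (dx + dy)) : xPart (z - w) = xPart z - xPart w := rfl
@[simp] theorem yPart_sub (z w : Vec (dx + dy)) : yPart (z - w) = yPart z - yPart w := rfl
@[simp] theorem xPart_smul (c : ℝ) (z : Vec (dx + dy)) : xPart (c • z) = c • xPart z := rfl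
@[simp] theorem yPart_smul (c : ℝ) (z : Vec (dx + dy)) : yPart (c • z) = c • yPart z := rfl

@[simp] theorem xPart_sum {ι : Type*} (s : Finset ι) (z : ι → Vec (dx + dy)) :
    xPart (∑ i ∈ s, z i) = ∑ i ∈ s, xPart (z i) := by
  ext i; simp [xPart]

@[simp] theorem yPart_sum {ι : Type*} (s : Finset ι) (z : ι → Vec (dx + dy)) :
    yPart (∑ i ∈ s, z i) = ∑ i ∈ s, yPart (z i) := by
  ext i; simp [yPart]

theorem inner_eq_parts (z w : Vec (dx + dy)) :
    ⟪z, w⟫ = ⟪xPart z, xPart w⟫ + ⟪yPart z, yPart w⟫ := by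
  simp [PiLp.inner_apply, Fin.sum_univ_add, xPart, yPart]

theorem norm_sq_eq_parts (z : Vec (dx + dy)) : ‖z‖ ^ 2 = ‖xPart z‖ ^ 2 + ‖yPart z‖ ^ 2 := by
  simp only [← real_inner_self_eq_norm_sq, inner_eq_parts]

theorem norm_xPart_le (z : Vec (dx + dy)) : ‖xPart z‖ ≤ ‖z‖ := by
  have := norm_sq_eq_parts z
  exact le_of_sq_le_sq (by nlinarith [sq_nonneg ‖yPart z‖]) (norm_nonneg _)

theorem norm_yPart_le (z : Vec (dx + dy)) : ‖yPart z‖ ≤ ‖z‖ := by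
  have := norm_sq_eq_parts z
  exact le_of_sq_le_sq (by nlinarith [sq_nonneg ‖xPart z‖]) (norm_nonneg _)

/-- The reflection `(x, y) ↦ (x, -y)`. -/
noncomputable def reflectY : Vec (dx + dy) →ₗᵢ[ℝ] Vec (dx + dy) where
  toFun z := join (xPart z) (-yPart z)
  map_add' z w := by
    ext i
    refine Fin.addCases (fun i => ?_) (fun i => ?_) i <;> simp [xPart, yPart, join, add_comm]
  map_smul' c z := by
    ext i
    refine Fin.addCases (fun i => ?_) (fun i => ?_) i <;> simp [xPart, yPart, join]
  norm_map' z := by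
    have h := norm_sq_eq_parts (join (xPart z) (-yPart z))
    rw [xPart_join, yPart_join, norm_neg, ← norm_sq_eq_parts] at h
    simpa using (sq_eq_sq₀ (norm_nonneg _) (norm_nonneg _)).mp h

theorem reflectY_apply (z : Vec (dx + dy)) : reflectY z = join (xPart z) (-yPart z) := rfl

end Blocks

theorem jacobian_mulVec {n : ℕ} (F : Vec n → Vec n) (z v : Vec n) :
    jacobian F z *ᵥ v.ofLp = (fderiv ℝ F z v).ofLp := by
  have hv : v = ∑ j, v j • EuclideanSpace.single j (1 : ℝ) := by
    ext i
    simp [Finset.sum_apply, Pi.single_apply]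
  ext i
  conv_rhs => rw [hv]
  simp [jacobian, Matrix.mulVec, dotProduct, mul_comm]

namespace ConvexConcave

variable {dx dy : ℕ} {f : Vec dx → Vec dy → ℝ} {ρ : ℝ}

theorem differentiable_joint (hf : ConvexConcave f ρ) : Differentiable ℝ (joint f) :=
  hf.contDiff.differentiable (by norm_num)

theorem contDiff_gradient (hf : ConvexConcave f ρ) : ContDiff ℝ 1 (gradient (joint f)) := by
  have h : ContDiff ℝ 1 (fderiv ℝ (joint f)) := hf.contDiff.fderiv_right (by norm_num)
  exact (InnerProductSpace.toDual ℝ (Vec (dx + dy))).symm.toContinuousLinearEquiv.contDiff.comp h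

theorem hasFDerivAt_fst (hf : ConvexConcave f ρ) (z : Vec (dx + dy)) :
    HasFDerivAt (fun x => f x (yPart z))
      (innerSL ℝ (xPart (gradient (joint f) z))) (xPart z) := by
  let L : Vec dx →L[ℝ] Vec (dx + dy) := LinearMap.toContinuousLinearMap
    { toFun := fun x => join x 0
      map_add' := fun u v => by
        ext i
        refine Fin.addCases (fun i => ?_) (fun i => ?_) i <;> simp [join]
      map_smul' := fun c u => by
        ext i
        refine Fin.addCases (fun i => ?_) (fun i => ?_) i <;> simp [join] }
  have hL : ∀ x, L x = join x 0 := fun x => rfl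
  have hj : ∀ x, join x (yPart z) = L (x - xPart z) + z := by
    intro x
    ext i
    refine Fin.addCases (fun i => ?_) (fun i => ?_) i <;> simp [hL, join, xPart, yPart]
  have h1 : (fun x => f x (yPart z)) = fun x => joint f (L (x - xPart z) + z) := by
    ext x
    rw [← hj, joint, xPart_join, yPart_join]
  have h2 : HasFDerivAt (fun x => L (x - xPart z) + z) L (xPart z) :=
    (L.hasFDerivAt.comp (xPart z) ((hasFDerivAt_id (xPart z)).sub_const (xPart z))).add_const z
  have h3 : HasFDerivAt (joint f) (fderiv ℝ (joint f) z) (L (xPart z - xPart z) + z) := by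
    simpa using (hf.differentiable_joint z).hasFDerivAt
  have h4 : innerSL ℝ (xPart (gradient (joint f) z)) = (fderiv ℝ (joint f) z).comp L := by
    refine ContinuousLinearMap.ext fun v => ?_
    have : fderiv ℝ (joint f) z (L v) = ⟪gradient (joint f) z, L v⟫ := by simp [gradient]
    rw [ContinuousLinearMap.comp_apply, this, hL, inner_eq_parts]
    simp
  rw [h1, h4]
  exact h3.comp (xPart z) h2

theorem hasFDerivAt_snd (hf : ConvexConcave f ρ) (z : Vec (dx + dy)) :
    HasFDerivAt (fun y => f (xPart z) y)
      (innerSL ℝ (yPart (gradient (joint f) z))) (yPart z) := by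
  let L : Vec dy →L[ℝ] Vec (dx + dy) := LinearMap.toContinuousLinearMap
    { toFun := fun y => join 0 y
      map_add' := fun u v => by
        ext i
        refine Fin.addCases (fun i => ?_) (fun i => ?_) i <;> simp [join]
      map_smul' := fun c u => by
        ext i
        refine Fin.addCases (fun i => ?_) (fun i => ?_) i <;> simp [join] }
  have hL : ∀ y, L y = join 0 y := fun y => rfl
  have hj : ∀ y, join (xPart z) y = L (y - yPart z) + z := by
    intro y
    ext i
    refine Fin.addCases (fun i => ?_) (fun i => ?_) i <;> simp [hL, join, xPart, yPart]
  have h1 : (fun y => f (xPart z) y) = fun y => joint f (L (y - yPart z) + z) := by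
    ext y
    rw [← hj, joint, xPart_join, yPart_join]
  have h2 : HasFDerivAt (fun y => L (y - yPart z) + z) L (yPart z) :=
    (L.hasFDerivAt.comp (yPart z) ((hasFDerivAt_id (yPart z)).sub_const (yPart z))).add_const z
  have h3 : HasFDerivAt (joint f) (fderiv ℝ (joint f) z) (L (yPart z - yPart z) + z) := by
    simpa using (hf.differentiable_joint z).hasFDerivAt
  have h4 : innerSL ℝ (yPart (gradient (joint f) z)) = (fderiv ℝ (joint f) z).comp L := by
    refine ContinuousLinearMap.ext fun v => ?_
    have : fderiv ℝ (joint f) z (L v) = ⟪gradient (joint f) z, L v⟫ := by simp [gradient]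
    rw [ContinuousLinearMap.comp_apply, this, hL, inner_eq_parts]
    simp
  rw [h1, h4]
  exact h3.comp (yPart z) h2

/-- The partial gradients are the blocks of the joint gradient. Since the reflection is an isometry,
F inherits the Lipschitz constant of the Hessian unchanged. -/
theorem gdaField_eq (hf : ConvexConcave f ρ) :
    gdaField f = fun z => reflectY (gradient (joint f) z) := by
  ext z i
  have hx : gradient (fun x => f x (yPart z)) (xPart z) = xPart (gradient (joint f) z) :=
    (hasGradientAt_iff_hasFDerivAt.mpr (hf.hasFDerivAt_fst z)).gradient
  have hy : gradient (fun y => f (xPart z) y) (yPart z) = yPart (gradient (joint f) z) :=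
    (hasGradientAt_iff_hasFDerivAt.mpr (hf.hasFDerivAt_snd z)).gradient
  simp only [gdaField, hx, hy]
  refine Fin.addCases (fun i => ?_) (fun i => ?_) i <;> simp [reflectY_apply, join]

theorem differentiable_gdaField (hf : ConvexConcave f ρ) : Differentiable ℝ (gdaField f) := by
  rw [hf.gdaField_eq]
  exact reflectY.toContinuousLinearMap.differentiable.comp
    (hf.contDiff_gradient.differentiable (by norm_num))

/-- The Jacobian of the gradient descent-ascent field is `ρ`-Lipschitz. -/
theorem fderiv_gdaField_lipschitz (hf : ConvexConcave f ρ) (z z' : Vec (dx + dy)) :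
    ‖fderiv ℝ (gdaField f) z - fderiv ℝ (gdaField f) z'‖ ≤ ρ * ‖z - z'‖ := by
  have h : ∀ w, fderiv ℝ (gdaField f) w =
      reflectY.toContinuousLinearMap.comp (hess (joint f) w) := by
    intro w
    rw [hf.gdaField_eq]
    exact (reflectY.toContinuousLinearMap.hasFDerivAt.comp w
      (hf.contDiff_gradient.differentiable (by norm_num) w).hasFDerivAt).fderiv
  rw [h, h, ← ContinuousLinearMap.comp_sub]
  refine le_trans ?_ (hf.hess_lipschitz z z')
  refine ContinuousLinearMap.opNorm_le_bound _ (norm_nonneg _) fun v => ?_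
  rw [ContinuousLinearMap.comp_apply, LinearIsometry.coe_toContinuousLinearMap,
    LinearIsometry.norm_map]
  exact ContinuousLinearMap.le_opNorm _ v

/-- The duality gap is bounded by the linearized gap. -/
theorem sub_le_inner_gdaField (hf : ConvexConcave f ρ) (w : Vec (dx + dy)) (x : Vec dx)
    (y : Vec dy) :
    f (xPart w) y - f x (yPart w) ≤ ⟪gdaField f w, w - join x y⟫ := by
  have h1 := (hf.convex (yPart w)).add_fderiv_le (hf.hasFDerivAt_fst w) x
  have h2 := (hf.concave (xPart w)).neg.add_fderiv_le (hf.hasFDerivAt_snd w).neg y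
  rw [hf.gdaField_eq, inner_eq_parts]
  simp only [reflectY_apply, xPart_join, yPart_join, xPart_sub, yPart_sub, inner_neg_left]
  simp only [innerSL_apply_apply, _root_.neg_apply, Pi.neg_apply,
    inner_sub_right] at h1 h2 ⊢
  linarith

/-- In the linearized gap bounds of z against w and of w against z the four values of f cancel. -/
theorem gdaField_monotone (hf : ConvexConcave f ρ) (z w : Vec (dx + dy)) :
    0 ≤ ⟪gdaField f z - gdaField f w, z - w⟫ := by
  have h1 := hf.sub_le_inner_gdaField z (xPart w) (yPart w)
  have h2 := hf.sub_le_inner_gdaField w (xPart z) (yPart z)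
  rw [join_xPart_yPart] at h1 h2
  rw [← neg_sub z w, inner_neg_right] at h2
  rw [inner_sub_left]
  linarith

/-- The gap of w against the saddle point is nonnegative because f(xs, ys) lies between its two
terms. This is all that the energy estimate needs to know about the saddle point. -/
theorem inner_gdaField_nonneg (hf : ConvexConcave f ρ) {zs : Vec (dx + dy)}
    (hs : IsSaddlePoint f (xPart zs) (yPart zs)) (w : Vec (dx + dy)) :
    0 ≤ ⟪gdaField f w, w - zs⟫ := by
  have h1 := hf.sub_le_inner_gdaField w (xPart zs) (yPart zs)
  have h2 := hs (xPart w) (yPart w)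
  rw [join_xPart_yPart] at h1
  linarith

theorem gdaField_saddle (hf : ConvexConcave f ρ) {zs : Vec (dx + dy)}
    (hs : IsSaddlePoint f (xPart zs) (yPart zs)) : gdaField f zs = 0 := by
  have hx : IsLocalMin (fun x => f x (yPart zs)) (xPart zs) :=
    Filter.Eventually.of_forall fun x => (hs x (yPart zs)).2
  have hy : IsLocalMax (fun y => f (xPart zs) y) (yPart zs) :=
    Filter.Eventually.of_forall fun y => (hs (xPart zs) y).1
  have h1 := hx.hasFDerivAt_eq_zero (hf.hasFDerivAt_fst zs)
  have h2 := hy.hasFDerivAt_eq_zero (hf.hasFDerivAt_snd zs)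
  have h1' : xPart (gradient (joint f) zs) = 0 := by
    rw [← inner_self_eq_zero (𝕜 := ℝ), ← innerSL_apply_apply (𝕜 := ℝ), h1]; rfl
  have h2' : yPart (gradient (joint f) zs) = 0 := by
    rw [← inner_self_eq_zero (𝕜 := ℝ), ← innerSL_apply_apply (𝕜 := ℝ), h2]; rfl
  rw [hf.gdaField_eq]
  simp only [reflectY_apply, h1', h2']
  ext i
  refine Fin.addCases (fun i => ?_) (fun i => ?_) i <;> simp [join]

end ConvexConcave

/-- The hypothesis also bounds both images on the relevant side and R ≥ 0 makes the balls nonempty,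
so `sSup` and `sInf` do not take default values. -/
theorem gap_le_of_forall {dx dy : ℕ} {f : Vec dx → Vec dy → ℝ} {xs : Vec dx} {ys : Vec dy}
    {R ε : ℝ} {xhat : Vec dx} {yhat : Vec dy} (hR : 0 ≤ R)
    (h : ∀ x y, ‖x - xs‖ ≤ R → ‖y - ys‖ ≤ R → f xhat y - f x yhat ≤ ε) :
    gap f xs ys R xhat yhat ≤ ε := by
  have hne : ∀ {n : ℕ} (c : Vec n), (Metric.closedBall c R).Nonempty := fun c =>
    Metric.nonempty_closedBall.mpr hR
  have hsup : ∀ x, ‖x - xs‖ ≤ R →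
      sSup ((fun y => f xhat y) '' Metric.closedBall ys R) ≤ ε + f x yhat := by
    intro x hx
    refine csSup_le ((hne ys).image _) ?_
    rintro _ ⟨y, hy, rfl⟩
    have := h x y hx (by simpa [dist_eq_norm] using hy)
    simp only
    linarith
  have hinf : sSup ((fun y => f xhat y) '' Metric.closedBall ys R) - ε ≤
      sInf ((fun x => f x yhat) '' Metric.closedBall xs R) := by
    refine le_csInf ((hne xs).image _) ?_
    rintro _ ⟨x, hx, rfl⟩
    have := hsup x (by simpa [dist_eq_norm] using hx)
    simp only
    linarith
  unfold gap
  linarith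

/-! ### Monotone fields with Lipschitz derivative -/

section Field

variable {E : Type*} [NormedAddCommGroup E] [InnerProductSpace ℝ E]

/-- The derivative of a monotone field is positive semidefinite. -/
theorem inner_fderiv_nonneg_of_monotone {F : E → E} (hmono : ∀ z w, 0 ≤ ⟪F z - F w, z - w⟫)
    (hF : Differentiable ℝ F) (z v : E) : 0 ≤ ⟪fderiv ℝ F z v, v⟫ := by
  -- Along a line, monotonicity of F is monotonicity of a real function, whose derivative at 0 is
  -- the quadratic form.
  set g : ℝ → ℝ := fun t => ⟪F (z + t • v), v⟫ with hg
  have hgm : Monotone g := by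
    intro s t hst
    rcases hst.eq_or_lt with rfl | hst
    · exact le_rfl
    have h := hmono (z + t • v) (z + s • v)
    have h2 : z + t • v - (z + s • v) = (t - s) • v := by rw [sub_smul]; abel
    rw [h2, inner_smul_right, inner_sub_left] at h
    have := nonneg_of_mul_nonneg_right h (sub_pos.mpr hst)
    simp only [hg]
    linarith
  have hline : HasDerivAt (fun t : ℝ => z + t • v) v 0 := by
    simpa using ((hasDerivAt_id (0 : ℝ)).smul_const v).const_add z
  have hFd : HasFDerivAt F (fderiv ℝ F z) (z + (0 : ℝ) • v) := by
    simpa using (hF z).hasFDerivAt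
  have hd : HasDerivAt g ⟪fderiv ℝ F z v, v⟫ 0 := by
    have := (hFd.comp_hasDerivAt (0 : ℝ) hline).inner ℝ (hasDerivAt_const (0 : ℝ) v)
    simpa using this
  rw [← hd.deriv]
  exact hgm.deriv_nonneg

/-- Accuracy of the linearization of `F` with the derivative taken at another point `c`. -/
theorem norm_linearization_error_le {F : E → E} {ρ : ℝ} (hρ : 0 ≤ ρ) (hF : Differentiable ℝ F)
    (hlip : ∀ z z', ‖fderiv ℝ F z - fderiv ℝ F z'‖ ≤ ρ * ‖z - z'‖) (c z w : E) :
    ‖F w - F z - fderiv ℝ F c (w - z)‖ ≤ ρ * (‖z - c‖ + ‖w - z‖) * ‖w - z‖ := by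
  -- Mean value inequality on [z, w], where the derivative differs from the one at c by at most ρ(‖z
  -- - c‖ + ‖w - z‖).
  refine (convex_segment z w).norm_image_sub_le_of_norm_fderiv_le' (fun x _ => hF x)
    (fun x hx => ?_) (left_mem_segment ℝ z w) (right_mem_segment ℝ z w)
  refine (hlip x c).trans (mul_le_mul_of_nonneg_left ?_ hρ)
  have h1 : ‖x - z‖ ≤ ‖w - z‖ := by
    have := norm_sub_le_of_mem_segment hx
    simpa [norm_sub_rev] using this
  have h2 : ‖x - c‖ ≤ ‖x - z‖ + ‖z - c‖ := norm_sub_le_norm_sub_add_norm_sub x z c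
  linarith

section Resolvent

variable {A : E →L[ℝ] E} (hA : ∀ v, 0 ≤ ⟪A v, v⟫)
include hA

/-- Positivity of A at u - v and Cauchy–Schwarz give (‖u‖ - ‖v‖)(γ₁‖u‖ - γ₂‖v‖) ≤ 0, and γ₁ ≤ γ₂
decides the sign of each factor. With γ = 1/η, the Newton step lengthens with η, but at most in
proportion. -/
theorem resolvent_comparison {γ₁ γ₂ : ℝ} (h₁ : 0 < γ₁) (h₂ : γ₁ ≤ γ₂) {u v : E}
    (huv : A u + γ₁ • u = A v + γ₂ • v) : ‖v‖ ≤ ‖u‖ ∧ γ₁ * ‖u‖ ≤ γ₂ * ‖v‖ := by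
  have h := hA (u - v)
  have h3 : A (u - v) = γ₂ • v - γ₁ • u := by
    rw [map_sub, sub_eq_sub_iff_add_eq_add, huv, add_comm]
  rw [h3] at h
  simp only [inner_sub_left, inner_sub_right, inner_smul_left, real_inner_self_eq_norm_sq,
    RCLike.conj_to_real, real_inner_comm u v] at h
  have hc := real_inner_le_norm u v
  have hu := norm_nonneg u
  have hv := norm_nonneg v
  have key : (‖u‖ - ‖v‖) * (γ₁ * ‖u‖ - γ₂ * ‖v‖) ≤ 0 := by
    have : (γ₁ + γ₂) * ⟪u, v⟫ ≤ (γ₁ + γ₂) * (‖u‖ * ‖v‖) :=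
      mul_le_mul_of_nonneg_left hc (by linarith)
    have e1 := real_inner_comm u v
    nlinarith
  constructor
  · by_contra hlt
    push Not at hlt
    have h4 : γ₁ * ‖u‖ < γ₂ * ‖v‖ := by nlinarith
    nlinarith [mul_pos_of_neg_of_neg (sub_neg.mpr hlt) (sub_neg.mpr h4)]
  · by_contra hlt
    push Not at hlt
    have h4 : ‖v‖ < ‖u‖ := by
      by_contra hle
      push Not at hle
      nlinarith
    nlinarith [mul_pos (sub_pos.mpr hlt) (sub_pos.mpr h4)]

theorem mul_norm_le_norm_resolvent {γ : ℝ} (u : E) : γ * ‖u‖ ≤ ‖A u + γ • u‖ := by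
  rcases eq_or_ne u 0 with rfl | hu
  · simp
  have hu' : 0 < ‖u‖ := norm_pos_iff.mpr hu
  have h := real_inner_le_norm (A u + γ • u) u
  rw [inner_add_left, inner_smul_left, real_inner_self_eq_norm_sq, RCLike.conj_to_real] at h
  have := hA u
  refine le_of_mul_le_mul_right ?_ hu'
  nlinarith

end Resolvent

variable {F : E → E} {ρ : ℝ} (hρ : 0 ≤ ρ) (hF : Differentiable ℝ F)
  (hlip : ∀ z z', ‖fderiv ℝ F z - fderiv ℝ F z'‖ ≤ ρ * ‖z - z'‖)
include hρ hF hlip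

/-- A regularized Newton direction at a point close to a zero of `F` is bounded independently
of the size of the derivative. -/
theorem norm_newton_direction_le (hmono : ∀ z w, 0 ≤ ⟪F z - F w, z - w⟫) {c z zs d : E} {D η : ℝ}
    (hzs : F zs = 0) (hz : ‖z - zs‖ ≤ D) (hc : ‖c - zs‖ ≤ D) (hη : 0 < η)
    (hd : fderiv ℝ F c d + (1 / η) • d = F z) : ‖d‖ ≤ 2 * D + 3 * ρ * D ^ 2 * η := by
  have hD : 0 ≤ D := (norm_nonneg _).trans hz
  have hcz : ‖zs - c‖ ≤ D := by rwa [norm_sub_rev]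
  have h1 := norm_linearization_error_le hρ hF hlip c zs z
  rw [hzs, sub_zero] at h1
  have h2 : ‖F z - fderiv ℝ F c (z - zs)‖ ≤ 2 * ρ * D ^ 2 := by
    refine h1.trans ?_
    have : ρ * (‖zs - c‖ + ‖z - zs‖) * ‖z - zs‖ ≤ ρ * (D + D) * D := by gcongr
    linarith
  -- Compare d with z - zs, which solves the unregularized equation up to 2ρD² because F zs = 0. The
  -- resolvent bound 1/γ makes the size of the derivative irrelevant.
  have h3 := mul_norm_le_norm_resolvent (inner_fderiv_nonneg_of_monotone hmono hF c)
    (γ := 1 / η) (d - (z - zs))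
  have h4 : fderiv ℝ F c (d - (z - zs)) + (1 / η) • (d - (z - zs)) =
      (F z - fderiv ℝ F c (z - zs)) - (1 / η) • (z - zs) := by
    rw [← hd, map_sub, smul_sub]; abel
  rw [h4] at h3
  have h5 : ‖(F z - fderiv ℝ F c (z - zs)) - (1 / η) • (z - zs)‖ ≤
      2 * ρ * D ^ 2 + (1 / η) * D := by
    refine (norm_sub_le _ _).trans (add_le_add h2 ?_)
    rw [norm_smul, Real.norm_of_nonneg (by positivity)]
    gcongr
  have h6 : ‖d - (z - zs)‖ ≤ 2 * ρ * D ^ 2 * η + D := by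
    have h := h3.trans h5
    rw [one_div, inv_mul_le_iff₀ hη] at h
    refine h.trans_eq ?_
    field_simp
  have h7 : ‖d‖ ≤ ‖d - (z - zs)‖ + ‖z - zs‖ := by
    simpa using norm_add_le (d - (z - zs)) (z - zs)
  have : 0 ≤ ρ * D ^ 2 * η := by positivity
  linarith

/-- The Newton equation leaves in F (z - d) only the linearization error and d/η, so a short step
certifies a small residual. -/
theorem norm_apply_newton_le {c z d : E} {p η : ℝ} (hp : ‖z - c‖ ≤ p) (hη : 0 < η)
    (hd : fderiv ℝ F c d + (1 / η) • d = F z) :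
    ‖F (z - d)‖ ≤ ‖d‖ * (1 / η + ρ * (p + ‖d‖)) := by
  have h1 := norm_linearization_error_le hρ hF hlip c z (z - d)
  have h2 : z - d - z = -d := by abel
  rw [h2, norm_neg, map_neg] at h1
  have h3 : F (z - d) = (F (z - d) - F z - -fderiv ℝ F c d) + (1 / η) • d := by
    rw [← hd]; abel
  rw [h3]
  refine (norm_add_le _ _).trans ?_
  rw [norm_smul, Real.norm_of_nonneg (by positivity : 0 ≤ 1 / η)]
  have h4 : ρ * (‖z - c‖ + ‖d‖) * ‖d‖ ≤ ρ * (p + ‖d‖) * ‖d‖ := by gcongr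
  nlinarith

end Field

/-! ### Inequalities for real sequences -/

section Sequences

/-- Here e and r stand for the two half-step lengths, and the inner sum bounds the distance to the
snapshot. Cauchy–Schwarz costs a factor j, and ∑ j ≤ m²/2 is compensated by the factor 1/m². This is
why the regularization must scale with m. -/
theorem sum_sq_le_of_epoch {m k : ℕ} (hm : 0 < m) (hk : k ≤ m) {e r : ℕ → ℝ}
    (he : ∀ j, 0 ≤ e j)
    (h : ∀ j < k, e j ≤ 1 / (3 * m) * (r j + ∑ i ∈ Finset.range j, (e i + r i))) :
    ∑ j ∈ Finset.range k, e j ^ 2 ≤ 4 / 7 * ∑ j ∈ Finset.range k, r j ^ 2 := by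
  set S := ∑ j ∈ Finset.range k, (e j + r j) ^ 2 with hS
  set A := ∑ j ∈ Finset.range k, e j ^ 2 with hA
  set R := ∑ j ∈ Finset.range k, r j ^ 2 with hR
  have hm1 : (1 : ℝ) ≤ m := by exact_mod_cast hm
  have hS0 : 0 ≤ S := Finset.sum_nonneg fun _ _ => sq_nonneg _
  have hR0 : 0 ≤ R := Finset.sum_nonneg fun _ _ => sq_nonneg _
  have hSAR : S ≤ 2 * A + 2 * R := by
    rw [hS, hA, hR, Finset.mul_sum, Finset.mul_sum, ← Finset.sum_add_distrib]
    exact Finset.sum_le_sum fun j _ => by nlinarith [sq_nonneg (e j - r j)]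
  have hj : ∀ j ∈ Finset.range k, 9 * (m : ℝ) ^ 2 * e j ^ 2 ≤ 2 * r j ^ 2 + 2 * (j * S) := by
    intro j hj
    have hjk := Finset.mem_range.mp hj
    set s := ∑ i ∈ Finset.range j, (e i + r i) with hs
    have h1 : s ^ 2 ≤ j * S := by
      have h1 := sq_sum_le_card_mul_sum_sq (s := Finset.range j) (f := fun i => e i + r i)
      rw [Finset.card_range] at h1
      refine h1.trans (mul_le_mul_of_nonneg_left ?_ (Nat.cast_nonneg j))
      exact Finset.sum_le_sum_of_subset_of_nonneg
        (Finset.range_subset_range.mpr hjk.le) fun _ _ _ => sq_nonneg _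
    have h2 := h j hjk
    rw [one_div, ← div_eq_inv_mul, le_div_iff₀ (by positivity)] at h2
    have h3 : (e j * (3 * m)) ^ 2 ≤ (r j + s) ^ 2 :=
      pow_le_pow_left₀ (mul_nonneg (he j) (by positivity)) h2 2
    nlinarith [sq_nonneg (r j - s)]
  have hid : 2 * ∑ j ∈ Finset.range k, (j : ℝ) ≤ (m : ℝ) ^ 2 := by
    have h1 : (∑ j ∈ Finset.range k, j) * 2 ≤ m ^ 2 := by
      rw [Finset.sum_range_id_mul_two, sq]
      exact Nat.mul_le_mul hk ((Nat.sub_le _ _).trans hk)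
    have h2 : (((∑ j ∈ Finset.range k, j) * 2 : ℕ) : ℝ) ≤ ((m ^ 2 : ℕ) : ℝ) := by exact_mod_cast h1
    push_cast at h2
    linarith
  have hsum := Finset.sum_le_sum hj
  rw [← Finset.mul_sum, Finset.sum_add_distrib, ← Finset.mul_sum, ← Finset.mul_sum,
    ← Finset.sum_mul] at hsum
  have h1 : (2 * ∑ j ∈ Finset.range k, (j : ℝ)) * S ≤ (m : ℝ) ^ 2 * (2 * A + 2 * R) :=
    mul_le_mul hid hSAR hS0 (by positivity)
  have hm2 : (1 : ℝ) ≤ (m : ℝ) ^ 2 := one_le_pow₀ hm1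
  -- From 9m²A ≤ 2R + m²(2A + 2R) follows 7m²A ≤ (2 + 2m²)R ≤ 4m²R.
  have h2 : (m : ℝ) ^ 2 * (7 * A) ≤ (m : ℝ) ^ 2 * (4 * R) := by nlinarith
  have := le_of_mul_le_mul_left h2 (by positivity)
  linarith

theorem sum_sq_le_of_lazy {m : ℕ} (hm : 0 < m) {e r : ℕ → ℝ} (he : ∀ j, 0 ≤ e j) (T : ℕ)
    (h : ∀ t < T, e t ≤ 1 / (3 * m) * (r t + ∑ s ∈ Finset.Ico (t - t % m) t, (e s + r s))) :
    ∑ t ∈ Finset.range T, e t ^ 2 ≤ 4 / 7 * ∑ t ∈ Finset.range T, r t ^ 2 := by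
  induction T using Nat.strong_induction_on with
  | _ T ih =>
    rcases Nat.eq_zero_or_pos T with rfl | hT
    · simp
    -- Split off the last epoch, complete or not. Dividing T - 1 keeps its length between 1 and m,
    -- so that the induction decreases also when m divides T.
    obtain ⟨q, k, hk0, hkm, rfl⟩ : ∃ q k, 0 < k ∧ k ≤ m ∧ T = m * q + k :=
      ⟨(T - 1) / m, (T - 1) % m + 1, by omega, Nat.mod_lt _ hm, by
        have := Nat.div_add_mod (T - 1) m
        omega⟩
    rw [Finset.sum_range_add, Finset.sum_range_add]
    have h1 := ih (m * q) (by omega) fun t ht => h t (by omega)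
    have h2 := sum_sq_le_of_epoch hm hkm (e := fun j => e (m * q + j))
      (r := fun j => r (m * q + j)) (fun j => he _) (by
        intro j hj
        have h3 := h (m * q + j) (by omega)
        have hmod : (m * q + j) % m = j := by
          rw [Nat.mul_add_mod, Nat.mod_eq_of_lt (by omega)]
        rw [hmod, Nat.add_sub_cancel, Finset.sum_Ico_eq_sum_range, Nat.add_sub_cancel_left] at h3
        exact h3)
    linarith

/-- The convex function x ↦ x^(-1/2) lies above its tangent at s², that is, 1/r ≥ 3/(2s) - r²/(2s³).
This amounts to (r - s)²(r + 2s) ≥ 0, and it is summed over t. -/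
theorem sum_inv_ge {T : ℕ} {r : ℕ → ℝ} {s : ℝ} (hs : 0 < s) (hr : ∀ t < T, 0 < r t)
    (h : ∑ t ∈ Finset.range T, r t ^ 2 ≤ T * s ^ 2) :
    T / s ≤ ∑ t ∈ Finset.range T, 1 / r t := by
  have h1 : ∀ t ∈ Finset.range T, 3 / (2 * s) - r t ^ 2 / (2 * s ^ 3) ≤ 1 / r t := by
    intro t ht
    have hrt := hr t (Finset.mem_range.mp ht)
    rw [div_sub_div _ _ (by positivity) (by positivity), div_le_div_iff₀ (by positivity) hrt]
    nlinarith [mul_nonneg (mul_nonneg hs.le (sq_nonneg (r t - s)))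
      (by positivity : 0 ≤ r t + 2 * s)]
  have h2 := Finset.sum_le_sum h1
  rw [Finset.sum_sub_distrib, Finset.sum_const, Finset.card_range, nsmul_eq_mul,
    ← Finset.sum_div] at h2
  refine le_trans ?_ h2
  have h3 : (∑ t ∈ Finset.range T, r t ^ 2) / (2 * s ^ 3) ≤ T * s ^ 2 / (2 * s ^ 3) := by gcongr
  have h4 : (T : ℝ) * (3 / (2 * s)) - T * s ^ 2 / (2 * s ^ 3) = T / s := by field_simp; ring
  linarith

end Sequences

/-! ### Convergence of the exact iteration -/

/-- The first `T` iterations of LEN with exact arithmetic: `z` are the iterates, `h` the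
extrapolated points and `η` the step sizes. -/
structure IsRun {E : Type*} [NormedAddCommGroup E] [InnerProductSpace ℝ E] (F : E → E) (m : ℕ)
    (M α : ℝ) (T : ℕ) (z h : ℕ → E) (η : ℕ → ℝ) : Prop where
  pos : ∀ t < T, 0 < η t
  newton : ∀ t < T, fderiv ℝ F (z (t - t % m)) (z t - h t) + (1 / η t) • (z t - h t) = F (z t)
  lower : ∀ t < T, 1 / (α * M) ≤ η t * ‖h t - z t‖
  upper : ∀ t < T, η t * ‖h t - z t‖ ≤ 1 / M
  next : ∀ t < T, z (t + 1) = z t - η t • F (h t)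

namespace IsRun

variable {E : Type*} [NormedAddCommGroup E] [InnerProductSpace ℝ E] {F : E → E} {m : ℕ}
  {M α ρ : ℝ} {T : ℕ} {z h : ℕ → E} {η : ℕ → ℝ}

theorem mono (H : IsRun F m M α T z h η) {t : ℕ} (ht : t ≤ T) : IsRun F m M α t z h η :=
  ⟨fun s hs => H.pos s (hs.trans_le ht), fun s hs => H.newton s (hs.trans_le ht),
    fun s hs => H.lower s (hs.trans_le ht), fun s hs => H.upper s (hs.trans_le ht),
    fun s hs => H.next s (hs.trans_le ht)⟩

theorem norm_next_sub_le (hm : 0 < m) (hρ : 0 < ρ) (hF : Differentiable ℝ F)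
    (hlip : ∀ z z', ‖fderiv ℝ F z - fderiv ℝ F z'‖ ≤ ρ * ‖z - z'‖)
    (H : IsRun F m (3 * ρ * m) α T z h η) {t : ℕ} (ht : t < T) :
    ‖z (t + 1) - h t‖ ≤ 1 / (3 * m) * (‖h t - z t‖ + ‖z t - z (t - t % m)‖) := by
  have hm' : (0 : ℝ) < m := by exact_mod_cast hm
  have hη := H.pos t ht
  have h1 := norm_linearization_error_le hρ.le hF hlip (z (t - t % m)) (z t) (h t)
  -- Multiplied by η, the Newton equation expresses z - h through F z and the stale derivative, so
  -- z_{t+1} - h is exactly -η times the linearization error.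
  have h2 : z (t + 1) - h t =
      -(η t • (F (h t) - F (z t) - fderiv ℝ F (z (t - t % m)) (h t - z t))) := by
    have h3 : fderiv ℝ F (z (t - t % m)) (h t - z t) =
        -fderiv ℝ F (z (t - t % m)) (z t - h t) := by rw [← map_neg, neg_sub]
    rw [H.next t ht, h3, ← H.newton t ht]
    simp only [smul_sub, smul_add, smul_neg, smul_smul, mul_one_div_cancel hη.ne', one_smul]
    abel
  rw [h2, norm_neg, norm_smul, Real.norm_of_nonneg hη.le]
  calc η t * ‖F (h t) - F (z t) - fderiv ℝ F (z (t - t % m)) (h t - z t)‖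
      ≤ η t * (ρ * (‖z t - z (t - t % m)‖ + ‖h t - z t‖) * ‖h t - z t‖) := by gcongr
    _ = (η t * ‖h t - z t‖) * (ρ * (‖h t - z t‖ + ‖z t - z (t - t % m)‖)) := by ring
    _ ≤ 1 / (3 * ρ * m) * (ρ * (‖h t - z t‖ + ‖z t - z (t - t % m)‖)) :=
        mul_le_mul_of_nonneg_right (H.upper t ht) (by positivity)
    _ = _ := by field_simp

theorem sum_norm_next_sub_sq_le (hm : 0 < m) (hρ : 0 < ρ) (hF : Differentiable ℝ F)
    (hlip : ∀ z z', ‖fderiv ℝ F z - fderiv ℝ F z'‖ ≤ ρ * ‖z - z'‖)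
    (H : IsRun F m (3 * ρ * m) α T z h η) :
    ∑ t ∈ Finset.range T, ‖z (t + 1) - h t‖ ^ 2 ≤
      4 / 7 * ∑ t ∈ Finset.range T, ‖h t - z t‖ ^ 2 := by
  refine sum_sq_le_of_lazy hm (e := fun t => ‖z (t + 1) - h t‖) (r := fun t => ‖h t - z t‖)
    (fun _ => norm_nonneg _) T fun t ht => ?_
  refine (H.norm_next_sub_le hm hρ hF hlip ht).trans ?_
  gcongr
  rw [norm_sub_rev, ← dist_eq_norm]
  refine (dist_le_Ico_sum_dist z (Nat.sub_le t _)).trans (Finset.sum_le_sum fun s _ => ?_)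
  rw [dist_eq_norm, norm_sub_rev]
  exact norm_sub_le_norm_sub_add_norm_sub _ _ _

/-- Each summand equals ⟪z_t - z_{t+1}, h_t - w⟫. Written as a combination of squared norms, it
telescopes. -/
theorem sum_inner_eq (H : IsRun F m M α T z h η) (w : E) :
    2 * ∑ t ∈ Finset.range T, η t * ⟪F (h t), h t - w⟫ =
      ‖z 0 - w‖ ^ 2 - ‖z T - w‖ ^ 2 - ∑ t ∈ Finset.range T, ‖h t - z t‖ ^ 2 +
        ∑ t ∈ Finset.range T, ‖z (t + 1) - h t‖ ^ 2 := by
  induction T with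
  | zero => simp
  | succ T ih =>
    have h1 := ih (H.mono T.le_succ)
    have h2 : η T * ⟪F (h T), h T - w⟫ = ⟪z T - z (T + 1), h T - w⟫ := by
      rw [H.next T T.lt_succ_self, sub_sub_cancel, inner_smul_left, RCLike.conj_to_real]
    have h3 : 2 * ⟪z T - z (T + 1), h T - w⟫ = ‖z T - w‖ ^ 2 - ‖z (T + 1) - w‖ ^ 2
        - ‖h T - z T‖ ^ 2 + ‖z (T + 1) - h T‖ ^ 2 := by
      have e1 : z T - z (T + 1) = (z T - h T) - (z (T + 1) - h T) := by abel
      have e2 : z T - w = (z T - h T) + (h T - w) := by abel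
      have e3 : z (T + 1) - w = (z (T + 1) - h T) + (h T - w) := by abel
      rw [e1, e2, e3, norm_sub_rev (h T), norm_add_sq_real, norm_add_sq_real, inner_sub_left]
      ring
    rw [Finset.sum_range_succ, Finset.sum_range_succ, Finset.sum_range_succ, mul_add, h1, h2, h3]
    ring

theorem sum_inner_le (hm : 0 < m) (hρ : 0 < ρ) (hF : Differentiable ℝ F)
    (hlip : ∀ z z', ‖fderiv ℝ F z - fderiv ℝ F z'‖ ≤ ρ * ‖z - z'‖)
    (H : IsRun F m (3 * ρ * m) α T z h η) (w : E) :
    2 * ∑ t ∈ Finset.range T, η t * ⟪F (h t), h t - w⟫ ≤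
      ‖z 0 - w‖ ^ 2 - ‖z T - w‖ ^ 2 - 3 / 7 * ∑ t ∈ Finset.range T, ‖h t - z t‖ ^ 2 := by
  rw [H.sum_inner_eq w]
  linarith [H.sum_norm_next_sub_sq_le hm hρ hF hlip]

section Saddle

variable (hm : 0 < m) (hρ : 0 < ρ) (hF : Differentiable ℝ F)
  (hlip : ∀ z z', ‖fderiv ℝ F z - fderiv ℝ F z'‖ ≤ ρ * ‖z - z'‖)
  (H : IsRun F m (3 * ρ * m) α T z h η) {zs : E} (hzs : ∀ w, 0 ≤ ⟪F w, w - zs⟫) {D : ℝ}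
  (hD : ‖z 0 - zs‖ ≤ D)
include hm hρ hF hlip H hzs hD

/-- Regret against w = zs is nonnegative by `hzs`, so the initial distance pays for both terms. -/
theorem energy_le :
    ‖z T - zs‖ ^ 2 + 3 / 7 * ∑ t ∈ Finset.range T, ‖h t - z t‖ ^ 2 ≤ D ^ 2 := by
  have h1 := H.sum_inner_le hm hρ hF hlip zs
  have h2 : 0 ≤ ∑ t ∈ Finset.range T, η t * ⟪F (h t), h t - zs⟫ :=
    Finset.sum_nonneg fun t ht =>
      mul_nonneg (H.pos t (Finset.mem_range.mp ht)).le (hzs _)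
  have h3 := pow_le_pow_left₀ (norm_nonneg _) hD 2
  linarith

/-- The energy bound applies to every prefix of the run. -/
theorem norm_sub_le {t : ℕ} (ht : t ≤ T) : ‖z t - zs‖ ≤ D := by
  have h1 := (H.mono ht).energy_le hm hρ hF hlip hzs hD
  have h2 : 0 ≤ ∑ s ∈ Finset.range t, ‖h s - z s‖ ^ 2 := Finset.sum_nonneg fun _ _ => sq_nonneg _
  exact le_of_sq_le_sq (by linarith) ((norm_nonneg _).trans hD)

theorem sum_norm_sq_le : ∑ t ∈ Finset.range T, ‖h t - z t‖ ^ 2 ≤ 7 / 3 * D ^ 2 := by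
  have h1 := H.energy_le hm hρ hF hlip hzs hD
  nlinarith [sq_nonneg ‖z T - zs‖]

theorem norm_half_sub_le {t : ℕ} (ht : t < T) : ‖h t - zs‖ ≤ 3 * D := by
  have hD0 : 0 ≤ D := (norm_nonneg _).trans hD
  have h1 := H.norm_sub_le hm hρ hF hlip hzs hD ht.le
  have h2 := H.sum_norm_sq_le hm hρ hF hlip hzs hD
  have h3 : ‖h t - z t‖ ^ 2 ≤ ∑ s ∈ Finset.range T, ‖h s - z s‖ ^ 2 :=
    Finset.single_le_sum (f := fun s => ‖h s - z s‖ ^ 2) (fun _ _ => sq_nonneg _)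
      (Finset.mem_range.mpr ht)
  have h4 : ‖h t - z t‖ ≤ 2 * D := le_of_sq_le_sq (by nlinarith) (by linarith)
  have h5 := norm_sub_le_norm_sub_add_norm_sub (h t) (z t) zs
  linarith

theorem weight_ge (hα : 1 < α) (hα2 : α ≤ 2) (hD0 : 0 < D) :
    (T : ℝ) ^ (3 / 2 : ℝ) ≤ 12 * ρ * m * D * ∑ t ∈ Finset.range T, η t := by
  rcases Nat.eq_zero_or_pos T with rfl | hT
  · simp [Real.zero_rpow]
  have hT' : (0 : ℝ) < T := by exact_mod_cast hT
  have hm' : (0 : ℝ) < m := by exact_mod_cast hm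
  have hM : 0 < 3 * ρ * m := by positivity
  have hr : ∀ t < T, 0 < ‖h t - z t‖ := by
    intro t ht
    have h1 : 0 < 1 / (α * (3 * ρ * m)) := by positivity
    exact pos_of_mul_pos_right (h1.trans_le (H.lower t ht)) (H.pos t ht).le
  -- With s = 2D/√T, the bound T s² = 4D² dominates (7/3) D². The lower end of the acceptance window
  -- and α ≤ 2 then turn 1/r into at most 6ρm η.
  have hs : 0 < 2 * D / √T := by positivity
  have h1 := sum_inv_ge (r := fun t => ‖h t - z t‖) hs hr (by
    have h2 := H.sum_norm_sq_le hm hρ hF hlip hzs hD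
    rw [div_pow, Real.sq_sqrt hT'.le, mul_div_cancel₀ _ hT'.ne']
    nlinarith)
  have h3 : ∑ t ∈ Finset.range T, 1 / ‖h t - z t‖ ≤
      ∑ t ∈ Finset.range T, (6 * ρ * m) * η t := by
    refine Finset.sum_le_sum fun t ht => ?_
    have ht := Finset.mem_range.mp ht
    have h4 := H.lower t ht
    have h5 : 1 / (6 * ρ * m) ≤ 1 / (α * (3 * ρ * m)) :=
      one_div_le_one_div_of_le (by positivity) (by nlinarith)
    have h6 := h5.trans h4
    rw [div_le_iff₀ (by positivity)] at h6
    rw [div_le_iff₀ (hr t ht)]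
    linarith
  rw [← Finset.mul_sum] at h3
  have h7 : (T : ℝ) ^ (3 / 2 : ℝ) = T * √T := by
    rw [Real.sqrt_eq_rpow, ← Real.rpow_one_add' hT'.le (by norm_num)]
    norm_num
  have h8 : (T : ℝ) / (2 * D / √T) = T * √T / (2 * D) := by field_simp
  rw [h8] at h1
  have h9 := h1.trans h3
  rw [div_le_iff₀ (by positivity)] at h9
  rw [h7]
  linarith

end Saddle

end IsRun

/-! ### The search for the step size -/

section Search

variable {n : ℕ} {Q U : Matrix (Fin n) (Fin n) ℂ} {z Fz : Vec n} {M α : ℝ}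

/-- A step size accepted by the search, with its Newton point. -/
structure IsAcceptable (Q U : Matrix (Fin n) (Fin n) ℂ) (z Fz : Vec n) (M α η : ℝ) (w : Vec n) :
    Prop where
  pos : 0 < η
  eq : w = (newtonStep Q U z Fz η).val
  lower : 1 / (α * M) ≤ η * ‖w - z‖
  upper : η * ‖w - z‖ ≤ 1 / M

theorem bisect_succ_val (K : ℕ) (lo hi : ℝ) :
    (bisect Q U z Fz M α (K + 1) lo hi).val =
      if √(lo * hi) * ‖(newtonStep Q U z Fz √(lo * hi)).val - z‖ ≤ 1 / M then
        if 1 / (α * M) ≤ √(lo * hi) * ‖(newtonStep Q U z Fz √(lo * hi)).val - z‖ then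
          some (√(lo * hi), (newtonStep Q U z Fz √(lo * hi)).val)
        else (bisect Q U z Fz M α K √(lo * hi) hi).val
      else (bisect Q U z Fz M α K lo √(lo * hi)).val := by
  simp only [bisect, Timed.val_bind, Timed.val_mul, Timed.val_sqrt, Timed.val_vsub,
    Timed.val_vnorm, Timed.val_div, Timed.val_le]
  split_ifs with h1 h2
  · simp only [Timed.val_bind, Timed.val_le, h2, if_true, Timed.val_pure]
  · simp only [Timed.val_bind, Timed.val_le, h2, if_false]
  · rfl

theorem isAcceptable_of_bisect {K : ℕ} {lo hi η : ℝ} {w : Vec n} (hlo : 0 < lo) (hhi : 0 < hi)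
    (h : (bisect Q U z Fz M α K lo hi).val = some (η, w)) : IsAcceptable Q U z Fz M α η w := by
  induction K generalizing lo hi with
  | zero => simp [bisect] at h
  | succ K ih =>
    have hmid : 0 < √(lo * hi) := Real.sqrt_pos.mpr (mul_pos hlo hhi)
    rw [bisect_succ_val] at h
    split_ifs at h with h1 h2
    · simp only [Option.some.injEq, Prod.mk.injEq] at h
      obtain ⟨rfl, rfl⟩ := h
      exact ⟨hmid, rfl, h2, h1⟩
    · exact ih hmid hhi h
    · exact ih hlo hmid h

variable {A : Vec n →L[ℝ] Vec n} (hA : ∀ v, 0 ≤ ⟪A v, v⟫)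
  (hN : ∀ η, 0 < η → A (z - (newtonStep Q U z Fz η).val) +
    (1 / η) • (z - (newtonStep Q U z Fz η).val) = Fz)
include hA hN

theorem norm_newtonStep_mono {η₁ η₂ : ℝ} (h₁ : 0 < η₁) (h : η₁ ≤ η₂) :
    ‖(newtonStep Q U z Fz η₁).val - z‖ ≤ ‖(newtonStep Q U z Fz η₂).val - z‖ ∧
      η₁ * ‖(newtonStep Q U z Fz η₂).val - z‖ ≤ η₂ * ‖(newtonStep Q U z Fz η₁).val - z‖ := by
  have h₂ : 0 < η₂ := h₁.trans_le h
  have := resolvent_comparison hA (γ₁ := 1 / η₂) (γ₂ := 1 / η₁) (by positivity)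
    (one_div_le_one_div_of_le h₁ h) ((hN η₂ h₂).trans (hN η₁ h₁).symm)
  rw [norm_sub_rev, norm_sub_rev z] at this
  refine ⟨this.1, ?_⟩
  have h3 := this.2
  rw [one_div_mul_eq_div, one_div_mul_eq_div, div_le_div_iff₀ h₂ h₁] at h3
  linarith

/-- Bisection preserves φ(lo) ≤ 1/(αM) and φ(hi) ≥ 1/M. Since φ(hi) ≤ (hi/lo)² φ(lo), every such
bracket satisfies α ≤ (hi/lo)², whereas each geometric midpoint halves log (hi/lo). -/
theorem log_le_of_bisect_eq_none (hM : 0 < M) (hα : 1 < α) {K : ℕ} {lo hi : ℝ} (hlo : 0 < lo)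
    (hle : lo ≤ hi) (hφlo : lo * ‖(newtonStep Q U z Fz lo).val - z‖ ≤ 1 / (α * M))
    (hφhi : 1 / M ≤ hi * ‖(newtonStep Q U z Fz hi).val - z‖)
    (h : (bisect Q U z Fz M α K lo hi).val = none) :
    2 ^ K * Real.log α ≤ 2 * Real.log (hi / lo) := by
  induction K generalizing lo hi with
  | zero =>
    have hhi : 0 < hi := hlo.trans_le hle
    have hα0 : 0 < α := by linarith
    have h1 := (norm_newtonStep_mono hA hN hlo hle).2
    have h2 : α ≤ (hi / lo) ^ 2 := by
      set a := ‖(newtonStep Q U z Fz lo).val - z‖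
      set b := ‖(newtonStep Q U z Fz hi).val - z‖
      rw [le_div_iff₀ (by positivity)] at hφlo
      rw [div_le_iff₀ hM] at hφhi
      rw [div_pow, le_div_iff₀ (by positivity)]
      have h3 : α * lo ^ 2 ≤ α * lo ^ 2 * (hi * b * M) :=
        le_mul_of_one_le_right (by positivity) hφhi
      have h4 : α * lo ^ 2 * (hi * b * M) = (α * lo * hi * M) * (lo * b) := by ring
      have h5 : (α * lo * hi * M) * (lo * b) ≤ (α * lo * hi * M) * (hi * a) :=
        mul_le_mul_of_nonneg_left h1 (by positivity)
      have h6 : (α * lo * hi * M) * (hi * a) = hi ^ 2 * (lo * a * (α * M)) := by ring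
      have h7 : hi ^ 2 * (lo * a * (α * M)) ≤ hi ^ 2 * 1 :=
        mul_le_mul_of_nonneg_left hφlo (by positivity)
      linarith
    have h8 := Real.log_le_log hα0 h2
    rw [Real.log_pow] at h8
    simpa using h8
  | succ K ih =>
    have hhi : 0 < hi := hlo.trans_le hle
    have hmid : 0 < √(lo * hi) := Real.sqrt_pos.mpr (mul_pos hlo hhi)
    have hlm : lo ≤ √(lo * hi) := Real.le_sqrt_of_sq_le (by nlinarith)
    have hmh : √(lo * hi) ≤ hi := Real.sqrt_le_iff.mpr ⟨hhi.le, by nlinarith⟩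
    have hlog : Real.log √(lo * hi) = (Real.log lo + Real.log hi) / 2 := by
      rw [Real.log_sqrt (by positivity), Real.log_mul hlo.ne' hhi.ne']
    rw [bisect_succ_val] at h
    rw [Real.log_div hhi.ne' hlo.ne', pow_succ]
    split_ifs at h with h1 h2
    · have := ih hmid hmh (not_le.mp h2).le hφhi h
      rw [Real.log_div hhi.ne' hmid.ne', hlog] at this
      linarith
    · have := ih hlo hlm hφlo (not_le.mp h1).le h
      rw [Real.log_div hmid.ne' hlo.ne', hlog] at this
      linarith

omit hA hN in
theorem search_val (η₀ : ℝ) (K : ℕ) :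
    (search Q U z Fz M α η₀ K).val =
      let w := (newtonStep Q U z Fz η₀).val
      let r := ‖w - z‖
      if r ≤ 0 then .halt w
      else if η₀ * r ≤ 1 / M ∧ 1 / (α * M) ≤ η₀ * r then .found η₀ w
      else match (if η₀ * r ≤ 1 / M then (bisect Q U z Fz M α K η₀ (1 / (M * r))).val
          else (bisect Q U z Fz M α K (1 / (α * M * r)) η₀).val) with
        | some (η, zhalf) => .found η zhalf
        | none => .halt w := by
  simp only [search, Timed.val_bind, Timed.val_vsub, Timed.val_vnorm, Timed.val_le]
  split_ifs with h1 h2 h3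
  · rfl
  · simp only [Timed.val_bind, Timed.val_mul, Timed.val_div, Timed.val_le, Bool.and_eq_true]
    rw [if_pos h2]
    rfl
  · simp only [Timed.val_bind, Timed.val_mul, Timed.val_div, Timed.val_le, Bool.and_eq_true]
    rw [if_neg h2]
    simp only [Timed.val_bind, Timed.val_mul, Timed.val_div, if_pos h3]
    generalize bisect Q U z Fz M α K η₀ _ = B
    rcases B with ⟨_ | ⟨_, _⟩, _⟩ <;> rfl
  · simp only [Timed.val_bind, Timed.val_mul, Timed.val_div, Timed.val_le, Bool.and_eq_true]
    rw [if_neg h2]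
    simp only [Timed.val_bind, Timed.val_mul, Timed.val_div, if_neg h3]
    generalize bisect Q U z Fz M α K _ η₀ = B
    rcases B with ⟨_ | ⟨_, _⟩, _⟩ <;> rfl

omit hA hN in
theorem isAcceptable_of_search (hM : 0 < M) (hα : 1 < α) {η₀ η : ℝ} (hη₀ : 0 < η₀) {K : ℕ}
    {w : Vec n} (h : (search Q U z Fz M α η₀ K).val = .found η w) :
    IsAcceptable Q U z Fz M α η w := by
  rw [search_val] at h
  simp only at h
  split_ifs at h with h1 h2 h3
  · simp only [SearchResult.found.injEq] at h
    obtain ⟨rfl, rfl⟩ := h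
    exact ⟨hη₀, rfl, h2.2, h2.1⟩
  · have hr := not_le.mp h1
    split at h
    · rename_i heq
      simp only [SearchResult.found.injEq] at h
      obtain ⟨rfl, rfl⟩ := h
      exact isAcceptable_of_bisect hη₀ (by positivity) heq
    · cases h
  · have hr := not_le.mp h1
    split at h
    · rename_i heq
      simp only [SearchResult.found.injEq] at h
      obtain ⟨rfl, rfl⟩ := h
      exact isAcceptable_of_bisect (by positivity) hη₀ heq
    · cases h

/-- If the search halts, then the trial Newton point is reported, and either the trial step is
zero or the initial bracket was too wide for `K` bisection steps. -/
theorem of_search_eq_halt (hM : 0 < M) (hα : 1 < α) {η₀ : ℝ} (hη₀ : 0 < η₀) {K : ℕ} {w : Vec n}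
    (h : (search Q U z Fz M α η₀ K).val = .halt w) :
    w = (newtonStep Q U z Fz η₀).val ∧ (‖w - z‖ = 0 ∨ 0 < ‖w - z‖ ∧
      (2 ^ K * Real.log α ≤ 2 * Real.log (1 / (M * ‖w - z‖ * η₀)) ∨
        2 ^ K * Real.log α ≤ 2 * Real.log (α * M * ‖w - z‖ * η₀))) := by
  have hα0 : 0 < α := by linarith
  rw [search_val] at h
  simp only at h
  split_ifs at h with h1 h2 h3
  · simp only [SearchResult.halt.injEq] at h
    subst h
    exact ⟨rfl, Or.inl (le_antisymm h1 (norm_nonneg _))⟩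
  · have hr := not_le.mp h1
    split at h
    · cases h
    · rename_i heq
      simp only [SearchResult.halt.injEq] at h
      subst h
      refine ⟨rfl, Or.inr ⟨hr, Or.inl ?_⟩⟩
      set r := ‖(newtonStep Q U z Fz η₀).val - z‖ with hrdef
      have hlow : η₀ * r < 1 / (α * M) := by
        by_contra hc
        exact h2 ⟨h3, not_lt.mp hc⟩
      have hle : η₀ ≤ 1 / (M * r) := by
        rw [le_div_iff₀ (by positivity)]
        rw [le_div_iff₀ hM] at h3
        linarith
      -- The Newton step at 1/(Mr) ≥ η₀ is at least as long as the trial step r, which brings φ up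
      -- to 1/M. The other bracket is symmetric.
      have hhi : 1 / M ≤ 1 / (M * r) * ‖(newtonStep Q U z Fz (1 / (M * r))).val - z‖ := by
        have h4 := (norm_newtonStep_mono hA hN hη₀ hle).1
        calc 1 / M = 1 / (M * r) * r := by field_simp
          _ ≤ _ := mul_le_mul_of_nonneg_left h4 (by positivity)
      have := log_le_of_bisect_eq_none hA hN hM hα hη₀ hle hlow.le hhi heq
      rwa [div_div] at this
  · have hr := not_le.mp h1
    split at h
    · cases h
    · rename_i heq
      simp only [SearchResult.halt.injEq] at h
      subst h
      refine ⟨rfl, Or.inr ⟨hr, Or.inr ?_⟩⟩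
      set r := ‖(newtonStep Q U z Fz η₀).val - z‖ with hrdef
      have h3 := not_le.mp h3
      have hle : 1 / (α * M * r) ≤ η₀ := by
        rw [div_le_iff₀ (by positivity)]
        rw [div_lt_iff₀ hM] at h3
        nlinarith
      have hlo : 1 / (α * M * r) * ‖(newtonStep Q U z Fz (1 / (α * M * r))).val - z‖ ≤
          1 / (α * M) := by
        have h4 := (norm_newtonStep_mono hA hN (by positivity) hle).1
        calc _ ≤ 1 / (α * M * r) * r := mul_le_mul_of_nonneg_left h4 (by positivity)
          _ = _ := by field_simp
      have := log_le_of_bisect_eq_none hA hN hM hα (by positivity) hle hlo h3.le heq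
      rwa [div_div_eq_mul_div, div_one, mul_comm η₀] at this

end Search

/-- The Newton step computed from a Schur decomposition of the Jacobian. -/
theorem newtonStep_jacobian {n : ℕ} (S : SchurRoutine n) {F : Vec n → Vec n} {c : Vec n}
    (hA : ∀ v, 0 ≤ ⟪fderiv ℝ F c v, v⟫) (z Fz : Vec n) {η : ℝ} (hη : 0 < η) :
    fderiv ℝ F c (z - (newtonStep (S.Q (jacobian F c)) (S.U (jacobian F c)) z Fz η).val) +
      (1 / η) • (z - (newtonStep (S.Q (jacobian F c)) (S.U (jacobian F c)) z Fz η).val) = Fz := by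
  have hmul : ∀ v : Vec n, (jacobian F c + (1 / η) • (1 : Matrix (Fin n) (Fin n) ℝ)) *ᵥ v.ofLp =
      (fderiv ℝ F c v + (1 / η) • v).ofLp := by
    intro v
    rw [Matrix.add_mulVec, jacobian_mulVec, Matrix.smul_mulVec, Matrix.one_mulVec]
    rfl
  have hdet : (jacobian F c + (1 / η) • (1 : Matrix (Fin n) (Fin n) ℝ)).det ≠ 0 := by
    intro h0
    obtain ⟨v, hv, hv0⟩ := Matrix.exists_mulVec_eq_zero_iff.mpr h0
    have h1 := hmul (WithLp.toLp 2 v)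
    rw [hv0] at h1
    have h2 := mul_norm_le_norm_resolvent hA (γ := 1 / η) (WithLp.toLp 2 v)
    have h3 : fderiv ℝ F c (WithLp.toLp 2 v) + (1 / η) • WithLp.toLp 2 v = 0 :=
      (WithLp.ofLp_injective 2) h1.symm
    rw [h3, norm_zero] at h2
    have h4 : ‖WithLp.toLp 2 v‖ ≤ 0 := by
      by_contra hc
      have := mul_pos (by positivity : 0 < 1 / η) (not_le.mp hc)
      linarith
    apply hv
    have := norm_le_zero_iff.mp h4
    simpa using this
  have := newtonStep_val S (jacobian F c) z Fz η hdet
  rw [hmul] at this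
  exact WithLp.ofLp_injective 2 this

/-! ### The main loop: its run and its cost -/

section Loop

variable {n : ℕ}

theorem sub_mod_succ {m t : ℕ} (h : (t + 1) % m ≠ 0) : t + 1 - (t + 1) % m = t - t % m := by
  have h1 := Nat.div_add_mod (t + 1) m
  have h2 := Nat.div_add_mod t m
  rw [Nat.succ_div_of_not_dvd fun hd => h (Nat.mod_eq_zero_of_dvd hd)] at h1
  omega

/-- The Schur factors in use in iteration `t`. -/
noncomputable def factors (P : Machine n) (m t : ℕ) (s : State n) :
    Matrix (Fin n) (Fin n) ℂ × Matrix (Fin n) (Fin n) ℂ :=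
  if t % m = 0 then (P.schur.Q (jacobian P.F s.z), P.schur.U (jacobian P.F s.z)) else (s.Q, s.U)

/-- The state after an iteration with step size `η` and extrapolated point `w`. -/
noncomputable def State.advance (P : Machine n) (m t : ℕ) (s : State n) (η : ℝ) (w : Vec n) :
    State n :=
  ⟨s.z - η • P.F w, (factors P m t s).1, (factors P m t s).2, s.weight + η, s.total + η • w⟩

/-- Value and cost branch on the same search result, so one unfolding of the iteration serves both.
-/
theorem lenLoop_succ (P : Machine n) (m : ℕ) (M α η₀ : ℝ) (K k t : ℕ) (s : State n) :
    (lenLoop P m M α η₀ K (k + 1) t s).val =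
      (match (search (factors P m t s).1 (factors P m t s).2 s.z (P.F s.z) M α η₀ K).val with
      | .halt w => w
      | .found η w => (lenLoop P m M α η₀ K k (t + 1) (s.advance P m t η w)).val) ∧
    (lenLoop P m M α η₀ K (k + 1) t s).cost =
      (if t % m = 0 then P.N * n + P.κ * n ^ 3 else 0) + (P.N +
      ((search (factors P m t s).1 (factors P m t s).2 s.z (P.F s.z) M α η₀ K).cost +
      match (search (factors P m t s).1 (factors P m t s).2 s.z (P.F s.z) M α η₀ K).val with
      | .halt _ => 0
      | .found η w => P.N + (n + (n + (1 + (n + (n +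
          (lenLoop P m M α η₀ K k (t + 1) (s.advance P m t η w)).cost))))))) := by
  have hQU : (if t % m = 0 then do
        let J ← P.evalJacobian s.z
        P.evalSchur J
      else
        return (s.Q, s.U) :
      Timed (Matrix (Fin n) (Fin n) ℂ × Matrix (Fin n) (Fin n) ℂ)) =
      ⟨factors P m t s, if t % m = 0 then P.N * n + P.κ * n ^ 3 else 0⟩ := by
    unfold factors
    split_ifs <;> rfl
  rw [lenLoop, hQU]
  simp only [Timed.val_bind, Timed.cost_bind]
  change (Timed.val (match (search (factors P m t s).1 (factors P m t s).2 s.z (P.F s.z) M α η₀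
    K).val with | .halt _ => _ | .found _ _ => _)) = _ ∧ _ + (P.N + ((search (factors P m t s).1
    (factors P m t s).2 s.z (P.F s.z) M α η₀ K).cost + Timed.cost (match (search
    (factors P m t s).1 (factors P m t s).2 s.z (P.F s.z) M α η₀ K).val with
      | .halt _ => _ | .found _ _ => _))) = _
  generalize search (factors P m t s).1 (factors P m t s).2 s.z (P.F s.z) M α η₀ K = R
  rcases R with ⟨⟨η, w⟩ | w, c⟩
  · simp [State.advance, Machine.evalF]
  · simp

/-- The loop produces a run of the method, and either completes it and returns the weighted
average, or stops in an iteration in which the search halts. -/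
theorem lenLoop_outcome (P : Machine n) (hA : ∀ c v, 0 ≤ ⟪fderiv ℝ P.F c v, v⟫) {m : ℕ}
    {M α η₀ : ℝ} (hM : 0 < M) (hα : 1 < α) (hη₀ : 0 < η₀) (K k t : ℕ) (s : State n)
    (z h : ℕ → Vec n) (η : ℕ → ℝ) (H : IsRun P.F m M α t z h η) (hz : s.z = z t)
    (hQU : t % m ≠ 0 → s.Q = P.schur.Q (jacobian P.F (z (t - t % m))) ∧
      s.U = P.schur.U (jacobian P.F (z (t - t % m))))
    (hw : s.weight = ∑ i ∈ Finset.range t, η i)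
    (ht : s.total = ∑ i ∈ Finset.range t, η i • h i) :
    ∃ (T : ℕ) (z' h' : ℕ → Vec n) (η' : ℕ → ℝ), z' 0 = z 0 ∧ IsRun P.F m M α T z' h' η' ∧
      ((T = t + k ∧ (lenLoop P m M α η₀ K k t s).val =
        (1 / ∑ i ∈ Finset.range T, η' i) • ∑ i ∈ Finset.range T, η' i • h' i) ∨
      (search (P.schur.Q (jacobian P.F (z' (T - T % m))))
        (P.schur.U (jacobian P.F (z' (T - T % m)))) (z' T) (P.F (z' T)) M α η₀ K).val =
          .halt (lenLoop P m M α η₀ K k t s).val) := by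
  induction k generalizing t s z h η with
  | zero =>
    refine ⟨t, z, h, η, rfl, H, Or.inl ⟨rfl, ?_⟩⟩
    simp [lenLoop, hw, ht]
  | succ k ih =>
    set c := z (t - t % m) with hc
    have hfac : factors P m t s = (P.schur.Q (jacobian P.F c), P.schur.U (jacobian P.F c)) := by
      unfold factors
      split_ifs with h0
      · rw [hc, h0, Nat.sub_zero, hz]
      · rw [(hQU h0).1, (hQU h0).2]
    have hval := (lenLoop_succ P m M α η₀ K k t s).1
    rw [hfac, hz] at hval
    rcases hres : (search (P.schur.Q (jacobian P.F c)) (P.schur.U (jacobian P.F c)) (z t)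
      (P.F (z t)) M α η₀ K).val with ⟨ηt, w⟩ | w
    · rw [hres] at hval
      simp only at hval
      have hacc := isAcceptable_of_search hM hα hη₀ hres
      have hnewton := newtonStep_jacobian P.schur (hA c) (z t) (P.F (z t)) hacc.pos
      rw [← hacc.eq] at hnewton
      -- The run is extended by overwriting entry t + 1 of z and entry t of h and η, none of which
      -- the shorter run constrains.
      set z' := Function.update z (t + 1) (z t - ηt • P.F w) with hz'
      set h' := Function.update h t w with hh'
      set η' := Function.update η t ηt with hη'
      have hz'i : ∀ i ≤ t, z' i = z i := fun i hi => Function.update_of_ne (by omega) _ _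
      have hh'i : ∀ i < t, h' i = h i := fun i hi => Function.update_of_ne (by omega) _ _
      have hη'i : ∀ i < t, η' i = η i := fun i hi => Function.update_of_ne (by omega) _ _
      have hz't : z' (t + 1) = z t - ηt • P.F w := Function.update_self ..
      have hh't : h' t = w := Function.update_self ..
      have hη't : η' t = ηt := Function.update_self ..
      have H' : IsRun P.F m M α (t + 1) z' h' η' := by
        constructor <;> intro i hi <;> rcases (Nat.lt_succ_iff_lt_or_eq.mp hi) with hi | rfl
        · rw [hη'i i hi]; exact H.pos i hi
        · rw [hη't]; exact hacc.pos
        · rw [hη'i i hi, hh'i i hi, hz'i i hi.le, hz'i _ ((Nat.sub_le _ _).trans hi.le)]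
          exact H.newton i hi
        · rw [hη't, hh't, hz'i i le_rfl, hz'i _ (Nat.sub_le _ _)]
          exact hnewton
        · rw [hη'i i hi, hh'i i hi, hz'i i hi.le]; exact H.lower i hi
        · rw [hη't, hh't, hz'i i le_rfl]; exact hacc.lower
        · rw [hη'i i hi, hh'i i hi, hz'i i hi.le]; exact H.upper i hi
        · rw [hη't, hh't, hz'i i le_rfl]; exact hacc.upper
        · rw [hη'i i hi, hh'i i hi, hz'i i hi.le, hz'i (i + 1) hi]; exact H.next i hi
        · rw [hη't, hh't, hz'i i le_rfl]; exact hz't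
      obtain ⟨T, z'', h'', η'', h0, hrun, hout⟩ := ih (t + 1) (s.advance P m t ηt w) z' h' η' H'
        (by rw [hz't, State.advance, hz])
        (by
          intro h0
          rw [sub_mod_succ h0, hz'i _ (Nat.sub_le _ _)]
          simp only [State.advance, hfac]
          exact ⟨rfl, rfl⟩)
        (by
          rw [Finset.sum_range_succ, hη't]
          simp only [State.advance, hw]
          congr 1
          exact Finset.sum_congr rfl fun i hi => (hη'i i (Finset.mem_range.mp hi)).symm)
        (by
          rw [Finset.sum_range_succ, hη't, hh't]
          simp only [State.advance, ht]
          congr 1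
          refine Finset.sum_congr rfl fun i hi => ?_
          rw [hη'i i (Finset.mem_range.mp hi), hh'i i (Finset.mem_range.mp hi)])
      refine ⟨T, z'', h'', η'', h0.trans (hz'i 0 (Nat.zero_le t)), hrun, ?_⟩
      rw [hval]
      rwa [show t + 1 + k = t + (k + 1) by omega] at hout
    · rw [hres] at hval
      simp only at hval
      refine ⟨t, z, h, η, rfl, H, Or.inr ?_⟩
      rw [hval]
      exact hres

/-- The constant 33 is 28 for the search plus 5, since the vector updates of an iteration take 4n +
1 ≤ 5n² operations. The final n + 1 pays for the average. -/
theorem lenLoop_cost_le (hn : 0 < n) (P : Machine n) (m : ℕ) (M α η₀ : ℝ) (K k t : ℕ)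
    (s : State n) : (lenLoop P m M α η₀ K k t s).cost ≤
      k * (2 * P.N + (K + 1) * (33 * n ^ 2)) +
        (∑ j ∈ Finset.range k, if (t + j) % m = 0 then 1 else 0) * (P.N * n + P.κ * n ^ 3) +
        (n + 1) := by
  induction k generalizing t s with
  | zero => simp [lenLoop, add_comm]
  | succ k ih =>
    rw [(lenLoop_succ P m M α η₀ K k t s).2, Finset.sum_range_succ']
    have hs := search_cost_le hn (factors P m t s).1 (factors P m t s).2 s.z (P.F s.z) M α η₀ K
    have hsum : ∑ j ∈ Finset.range k, (if (t + (j + 1)) % m = 0 then 1 else 0) =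
        ∑ j ∈ Finset.range k, if (t + 1 + j) % m = 0 then 1 else 0 := by
      refine Finset.sum_congr rfl fun j _ => ?_
      rw [show t + (j + 1) = t + 1 + j by omega]
    rw [hsum, add_zero]
    have hrec := fun s => ih (t + 1) s
    set G := P.N * n + P.κ * n ^ 3
    set B := ∑ j ∈ Finset.range k, if (t + 1 + j) % m = 0 then 1 else 0
    have h1 : (if t % m = 0 then G else 0) = (if t % m = 0 then 1 else 0) * G := by
      split_ifs <;> simp
    rw [h1, add_mul B]
    generalize (if t % m = 0 then 1 else 0) * G = a
    have h2 : ∀ x y : ℕ, x ≤ (K + 1) * (28 * n ^ 2) →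
        y ≤ k * (2 * P.N + (K + 1) * (33 * n ^ 2)) + B * G + (n + 1) →
        a + (P.N + (x + (P.N + (n + (n + (1 + (n + (n + y)))))))) ≤
          (k + 1) * (2 * P.N + (K + 1) * (33 * n ^ 2)) + (B * G + a) + (n + 1) := by
      intro x y hx hy
      have h3 : 4 * n + 1 ≤ (K + 1) * (5 * n ^ 2) := by nlinarith
      have h4 : (K + 1) * (33 * n ^ 2) = (K + 1) * (28 * n ^ 2) + (K + 1) * (5 * n ^ 2) := by ring
      have h5 : (k + 1) * (2 * P.N + (K + 1) * (33 * n ^ 2)) =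
        k * (2 * P.N + (K + 1) * (33 * n ^ 2)) + (2 * P.N + (K + 1) * (33 * n ^ 2)) := by ring
      omega
    split
    · have := h2 _ 0 hs (Nat.zero_le _)
      omega
    · exact h2 _ _ hs (hrec _)

theorem sum_multiples_eq {m : ℕ} (hm : 0 < m) (T : ℕ) :
    ∑ j ∈ Finset.range T, (if j % m = 0 then 1 else 0) = (T + (m - 1)) / m := by
  induction T with
  | zero => simp [Nat.div_eq_of_lt (Nat.sub_lt hm one_pos)]
  | succ T ih =>
    rw [Finset.sum_range_succ, ih, show T + 1 + (m - 1) = T + (m - 1) + 1 by omega, Nat.succ_div]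
    have h : m ∣ T + (m - 1) + 1 ↔ T % m = 0 := by
      rw [show T + (m - 1) + 1 = T + m by omega, Nat.dvd_add_self_right, Nat.dvd_iff_mod_eq_zero]
    simp only [h]

theorem len_cost_le (hn : 0 < n) (P : Machine n) (z₀ : Vec n) {m : ℕ} (hm : 0 < m) (M α η₀ : ℝ)
    (T K : ℕ) : ((len P z₀ T m M α η₀ K).cost : ℝ) ≤
      T * (2 * P.N + (K + 1) * (33 * n ^ 2)) + (T / m + 1) * (P.N * n + P.κ * n ^ 3) +
        (n + 1) := by
  have h := lenLoop_cost_le hn P m M α η₀ K T 0 ⟨z₀, 0, 0, 0, 0⟩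
  simp only [zero_add, sum_multiples_eq hm] at h
  have h1 : ((len P z₀ T m M α η₀ K).cost : ℝ) ≤ ((T * (2 * P.N + (K + 1) * (33 * n ^ 2)) +
      ((T + (m - 1)) / m) * (P.N * n + P.κ * n ^ 3) + (n + 1) : ℕ) : ℝ) := by
    exact_mod_cast h
  refine h1.trans ?_
  push_cast
  gcongr
  have hm' : (0 : ℝ) < m := by exact_mod_cast hm
  refine Nat.cast_div_le.trans ?_
  rw [div_add_one hm'.ne']
  have h2 : ((T + (m - 1) : ℕ) : ℝ) ≤ ((T + m : ℕ) : ℝ) := by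
    exact_mod_cast Nat.add_le_add_left (Nat.sub_le m 1) T
  push_cast at h2 ⊢
  gcongr

end Loop

/-! ### Quality of the returned point -/

section Output

variable {dx dy : ℕ} {f : Vec dx → Vec dy → ℝ} {ρ D ε : ℝ} {zs z₀ : Vec (dx + dy)}

theorem norm_join_sub_le (hD : 0 ≤ D) {x : Vec dx} {y : Vec dy} (hx : ‖x - xPart zs‖ ≤ 3 * D)
    (hy : ‖y - yPart zs‖ ≤ 3 * D) : ‖join x y - zs‖ ≤ 5 * D := by
  have h := norm_sq_eq_parts (join x y - zs)
  rw [xPart_sub, yPart_sub, xPart_join, yPart_join] at h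
  have h1 := pow_le_pow_left₀ (norm_nonneg _) hx 2
  have h2 := pow_le_pow_left₀ (norm_nonneg _) hy 2
  exact le_of_sq_le_sq (by nlinarith) (by linarith)

theorem isEpsSaddlePoint_of_forall (hD : 0 ≤ D) (hz₀ : ‖z₀ - zs‖ ≤ D) {w : Vec (dx + dy)}
    (hw : ‖w - zs‖ ≤ 3 * D)
    (h : ∀ x y, ‖join x y - zs‖ ≤ 5 * D → f (xPart w) y - f x (yPart w) ≤ ε) :
    IsEpsSaddlePoint f zs z₀ (3 * D) ε w where
  point_mem := by
    rw [← xPart_sub, ← yPart_sub]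
    exact max_le ((norm_xPart_le _).trans hw) ((norm_yPart_le _).trans hw)
  start_mem := by
    rw [← xPart_sub, ← yPart_sub]
    exact max_le ((norm_xPart_le _).trans (by linarith)) ((norm_yPart_le _).trans (by linarith))
  gap_le := gap_le_of_forall (by linarith) fun x y hx hy => h x y (norm_join_sub_le hD hx hy)

/-- A trial Newton point with a short step is an approximate saddle point. -/
theorem isEpsSaddlePoint_of_short_step (hf : ConvexConcave f ρ) (hρ : 0 ≤ ρ)
    (hz₀ : ‖z₀ - zs‖ ≤ D) {c z w : Vec (dx + dy)} {η : ℝ} (hη : 0 < η) (hz : ‖z - zs‖ ≤ D)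
    (hc : ‖c - zs‖ ≤ D)
    (hw : fderiv ℝ (gdaField f) c (z - w) + (1 / η) • (z - w) = gdaField f z)
    (hr : ‖w - z‖ ≤ D) (hrε : ‖w - z‖ * (7 * D * (1 / η + 3 * ρ * D)) ≤ ε) :
    IsEpsSaddlePoint f zs z₀ (3 * D) ε w := by
  have hD : 0 ≤ D := (norm_nonneg _).trans hz
  have hwz : ‖w - zs‖ ≤ 2 * D := by
    have := norm_sub_le_norm_sub_add_norm_sub w z zs
    linarith
  have hzc : ‖z - c‖ ≤ 2 * D := by
    have := norm_sub_le_norm_sub_add_norm_sub z zs c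
    rw [norm_sub_rev zs c] at this
    linarith
  have h1 := norm_apply_newton_le hρ hf.differentiable_gdaField hf.fderiv_gdaField_lipschitz hzc
    hη hw
  rw [sub_sub_cancel, norm_sub_rev] at h1
  refine isEpsSaddlePoint_of_forall hD hz₀ (by linarith) fun x y hxy => ?_
  have h2 : ‖w - join x y‖ ≤ 7 * D := by
    have := norm_sub_le_norm_sub_add_norm_sub w zs (join x y)
    rw [norm_sub_rev zs] at this
    linarith
  calc f (xPart w) y - f x (yPart w) ≤ ⟪gdaField f w, w - join x y⟫ :=
        hf.sub_le_inner_gdaField w x y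
    _ ≤ ‖gdaField f w‖ * ‖w - join x y‖ := real_inner_le_norm _ _
    _ ≤ (‖w - z‖ * (1 / η + ρ * (2 * D + D))) * (7 * D) := by
        refine mul_le_mul (h1.trans ?_) h2 (norm_nonneg _) (by positivity)
        gcongr
    _ = ‖w - z‖ * (7 * D * (1 / η + 3 * ρ * D)) := by ring
    _ ≤ ε := hrε

/-- The weighted average of a long run is an approximate saddle point. -/
theorem isEpsSaddlePoint_of_run (hf : ConvexConcave f ρ) (hρ : 0 < ρ)
    (hs : IsSaddlePoint f (xPart zs) (yPart zs)) (hD : 0 < D) (hε : 0 < ε) {m T : ℕ} (hm : 0 < m)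
    {α : ℝ} (hα : 1 < α) (hα2 : α ≤ 2) {z h : ℕ → Vec (dx + dy)} {η : ℕ → ℝ}
    (H : IsRun (gdaField f) m (3 * ρ * m) α T z h η) (hz₀ : ‖z 0 - zs‖ ≤ D)
    (hT : 216 * ρ * m * D ^ 3 / ε ≤ (T : ℝ) ^ (3 / 2 : ℝ)) :
    IsEpsSaddlePoint f zs (z 0) (3 * D) ε
      ((1 / ∑ i ∈ Finset.range T, η i) • ∑ i ∈ Finset.range T, η i • h i) := by
  have hm' : (0 : ℝ) < m := by exact_mod_cast hm
  set W := ∑ i ∈ Finset.range T, η i with hW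
  have hF := hf.differentiable_gdaField
  have hlip := hf.fderiv_gdaField_lipschitz
  have hzs := hf.inner_gdaField_nonneg hs
  have hWT := hT.trans (H.weight_ge hm hρ hF hlip hzs hz₀ hα hα2 hD)
  -- Competitors lie within √18 D ≤ 5D of zs, hence within 6D of z 0, so the regret is at most
  -- (6D)²/2 = 18D². Thus 216 = 12 · 18.
  have hWD : 18 * D ^ 2 ≤ ε * W := by
    rw [div_le_iff₀ hε] at hWT
    have : 12 * ρ * m * D * (18 * D ^ 2) ≤ 12 * ρ * m * D * (ε * W) := by
      refine le_trans (le_of_eq ?_) (hWT.trans (le_of_eq ?_)) <;> ring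
    exact le_of_mul_le_mul_left this (by positivity)
  have hW0 : 0 < W := by
    have : 0 < ε * W := lt_of_lt_of_le (by positivity) hWD
    exact pos_of_mul_pos_right this hε.le
  set lam : ℕ → ℝ := fun i => η i / W with hlam
  have hlam0 : ∀ i ∈ Finset.range T, 0 ≤ lam i := fun i hi =>
    div_nonneg (H.pos i (Finset.mem_range.mp hi)).le hW0.le
  have hlam1 : ∑ i ∈ Finset.range T, lam i = 1 := by
    rw [hlam, ← Finset.sum_div, div_self hW0.ne']
  have havg : (1 / W) • ∑ i ∈ Finset.range T, η i • h i = ∑ i ∈ Finset.range T, lam i • h i := by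
    rw [Finset.smul_sum]
    refine Finset.sum_congr rfl fun i _ => ?_
    rw [smul_smul, one_div_mul_eq_div]
  rw [havg]
  refine isEpsSaddlePoint_of_forall hD.le hz₀ ?_ fun x y hxy => ?_
  · have h1 : ∑ i ∈ Finset.range T, lam i • h i ∈ Metric.closedBall zs (3 * D) :=
      (convex_closedBall zs (3 * D)).sum_mem hlam0 hlam1 fun i hi => by
        rw [Metric.mem_closedBall, dist_eq_norm]
        exact H.norm_half_sub_le hm hρ hF hlip hzs hz₀ (Finset.mem_range.mp hi)
    rwa [Metric.mem_closedBall, dist_eq_norm] at h1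
  · have hx : f (xPart (∑ i ∈ Finset.range T, lam i • h i)) y ≤
        ∑ i ∈ Finset.range T, lam i * f (xPart (h i)) y := by
      have := (hf.convex y).map_sum_le (p := fun i => xPart (h i)) hlam0 hlam1
        fun _ _ => Set.mem_univ _
      simpa using this
    have hy : ∑ i ∈ Finset.range T, lam i * f x (yPart (h i)) ≤
        f x (yPart (∑ i ∈ Finset.range T, lam i • h i)) := by
      have := (hf.concave x).le_map_sum (p := fun i => yPart (h i)) hlam0 hlam1
        fun _ _ => Set.mem_univ _
      simpa using this
    have hz0 : ‖z 0 - join x y‖ ^ 2 ≤ 36 * D ^ 2 := by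
      have h1 := norm_sub_le_norm_sub_add_norm_sub (z 0) zs (join x y)
      rw [norm_sub_rev zs] at h1
      have h2 := pow_le_pow_left₀ (norm_nonneg _) (h1.trans (add_le_add hz₀ hxy)) 2
      linarith
    have hreg := H.sum_inner_le hm hρ hF hlip (join x y)
    have hr0 : 0 ≤ ∑ t ∈ Finset.range T, ‖h t - z t‖ ^ 2 :=
      Finset.sum_nonneg fun _ _ => sq_nonneg _
    have hin : ∑ i ∈ Finset.range T, η i * ⟪gdaField f (h i), h i - join x y⟫ ≤ 18 * D ^ 2 := by
      nlinarith [sq_nonneg ‖z T - join x y‖]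
    calc f (xPart (∑ i ∈ Finset.range T, lam i • h i)) y -
          f x (yPart (∑ i ∈ Finset.range T, lam i • h i))
        ≤ ∑ i ∈ Finset.range T, lam i * f (xPart (h i)) y -
          ∑ i ∈ Finset.range T, lam i * f x (yPart (h i)) := sub_le_sub hx hy
      _ = ∑ i ∈ Finset.range T, lam i * (f (xPart (h i)) y - f x (yPart (h i))) := by
        rw [← Finset.sum_sub_distrib]
        exact Finset.sum_congr rfl fun i _ => by ring
      _ ≤ ∑ i ∈ Finset.range T, lam i * ⟪gdaField f (h i), h i - join x y⟫ :=
        Finset.sum_le_sum fun i hi =>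
          mul_le_mul_of_nonneg_left (hf.sub_le_inner_gdaField _ _ _) (hlam0 i hi)
      _ = (∑ i ∈ Finset.range T, η i * ⟪gdaField f (h i), h i - join x y⟫) / W := by
        rw [Finset.sum_div]
        exact Finset.sum_congr rfl fun i _ => by rw [hlam]; ring
      _ ≤ ε := by
        rw [div_le_iff₀ hW0]
        linarith

end Output

/-! ### Choice of the number of iterations and bisection steps -/

/-- The argument of the inner logarithm in the complexity bound. -/
noncomputable def problemSize (m : ℕ) (ρ D ε η₀ : ℝ) : ℝ :=
  2 + m + ρ + ρ⁻¹ + D + D⁻¹ + η₀ + η₀⁻¹ + ε⁻¹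

section Parameters

variable {m : ℕ} {ρ D ε η₀ α : ℝ} (hm : 0 < m) (hρ : 0 < ρ) (hD : 0 < D) (hε : 0 < ε)
  (hη₀ : 0 < η₀)

include hρ hD hε hη₀ in
theorem le_problemSize : 2 ≤ problemSize m ρ D ε η₀ ∧ m ≤ problemSize m ρ D ε η₀ ∧
    ρ ≤ problemSize m ρ D ε η₀ ∧ ρ⁻¹ ≤ problemSize m ρ D ε η₀ ∧ D ≤ problemSize m ρ D ε η₀ ∧
    D⁻¹ ≤ problemSize m ρ D ε η₀ ∧ η₀ ≤ problemSize m ρ D ε η₀ ∧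
    η₀⁻¹ ≤ problemSize m ρ D ε η₀ ∧ ε⁻¹ ≤ problemSize m ρ D ε η₀ := by
  have h1 := inv_pos.mpr hρ
  have h2 := inv_pos.mpr hD
  have h3 := inv_pos.mpr hε
  have h4 := inv_pos.mpr hη₀
  have h5 : (0 : ℝ) ≤ m := Nat.cast_nonneg m
  unfold problemSize
  refine ⟨?_, ?_, ?_, ?_, ?_, ?_, ?_, ?_, ?_⟩ <;> linarith

theorem mul_pow_le_pow_of_two_le {X : ℝ} (hX : 2 ≤ X) {c : ℝ} {k j : ℕ} (hc : c ≤ 2 ^ j) :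
    c * X ^ k ≤ X ^ (j + k) := by
  rw [pow_add]
  exact mul_le_mul_of_nonneg_right (hc.trans (pow_le_pow_left₀ (by norm_num) hX j)) (by positivity)

include hm hρ hD hε hη₀

/-- With enough bisection steps, the search halts only at points with a short trial step. -/
theorem short_step_of_log_le (hα : 1 < α) (hα2 : α ≤ 2) {r : ℝ} (hr : 0 < r)
    (hr2 : r ≤ 2 * D + 3 * ρ * D ^ 2 * η₀) {K : ℕ}
    (hK : 24 * Real.log (problemSize m ρ D ε η₀) < 2 ^ K * Real.log α)
    (h : 2 ^ K * Real.log α ≤ 2 * Real.log (1 / (3 * ρ * m * r * η₀)) ∨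
      2 ^ K * Real.log α ≤ 2 * Real.log (α * (3 * ρ * m) * r * η₀)) :
    r ≤ D ∧ r * (7 * D * (1 / η₀ + 3 * ρ * D)) ≤ ε := by
  obtain ⟨hX2, hXm, hXρ, hXρ', hXD, hXD', hXη, hXη', hXε⟩ := le_problemSize (m := m) hρ hD hε hη₀
  set X := problemSize m ρ D ε η₀
  have hX0 : 0 < X := by linarith
  have hX1 : 1 ≤ X := by linarith
  have hm1 : (1 : ℝ) ≤ m := by exact_mod_cast hm
  -- Since 24 = 2 · 12, a bracket ratio of at most X^12 contradicts failure of the search. It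
  -- remains to bound the ratios by polynomials in X, whose constants are absorbed using X ≥ 2.
  have hlog : ∀ B, 0 < B → B ≤ X ^ 12 → 2 * Real.log B < 2 ^ K * Real.log α := by
    intro B hB hBX
    have h1 := Real.log_le_log hB hBX
    rw [Real.log_pow] at h1
    push_cast at h1
    linarith
  have hMr : 0 < 3 * ρ * m * r * η₀ := by positivity
  have hinv : (3 * ρ * m)⁻¹ ≤ X := by
    refine le_trans ?_ hXρ'
    exact inv_anti₀ hρ (by nlinarith)
  have hsplit : 1 / (3 * ρ * m * r * η₀) = (3 * ρ * m)⁻¹ * η₀⁻¹ * r⁻¹ := by field_simp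
  rcases h with h | h
  · constructor
    · by_contra hc
      have hc := not_le.mp hc
      refine absurd h (not_le.mpr (hlog _ (by positivity) ?_))
      have h1 : r⁻¹ ≤ X := (inv_anti₀ hD hc.le).trans hXD'
      calc 1 / (3 * ρ * m * r * η₀) = (3 * ρ * m)⁻¹ * η₀⁻¹ * r⁻¹ := hsplit
        _ ≤ X * X * X := by gcongr
        _ = X ^ 3 := by ring
        _ ≤ X ^ 12 := pow_le_pow_right₀ hX1 (by norm_num)
    · by_contra hc
      have hc := not_le.mp hc
      refine absurd h (not_le.mpr (hlog _ (by positivity) ?_))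
      have h1 : r⁻¹ ≤ ε⁻¹ * (7 * D * (1 / η₀ + 3 * ρ * D)) := by
        rw [inv_mul_eq_div, le_div_iff₀ hε, inv_mul_le_iff₀ hr]
        exact hc.le
      have h2 : 1 / η₀ ≤ X ^ 2 := by
        rw [one_div]; nlinarith
      calc 1 / (3 * ρ * m * r * η₀) = (3 * ρ * m)⁻¹ * η₀⁻¹ * r⁻¹ := hsplit
        _ ≤ X * X * (X * (7 * X * (X ^ 2 + 3 * X * X))) := by
          refine mul_le_mul (by gcongr) (h1.trans ?_) (by positivity) (by positivity)
          gcongr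
        _ = 28 * X ^ 6 := by ring
        _ ≤ X ^ (5 + 6) := mul_pow_le_pow_of_two_le hX2 (by norm_num)
        _ ≤ X ^ 12 := pow_le_pow_right₀ hX1 (by norm_num)
  -- This bracket is wide only if the trial step is long, which `hr2` excludes.
  · refine absurd h (not_le.mpr (hlog _ (by positivity) ?_))
    have h1 : r ≤ 5 * X ^ 4 := by
      refine hr2.trans ?_
      have h2 : ρ * D ^ 2 * η₀ ≤ X * X ^ 2 * X := by gcongr
      have h3 : X ≤ X ^ 4 := le_self_pow₀ hX1 (by norm_num)
      have h4 : X * X ^ 2 * X = X ^ 4 := by ring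
      linarith
    calc α * (3 * ρ * m) * r * η₀ ≤ 2 * (3 * X * X) * (5 * X ^ 4) * X := by gcongr
      _ = 30 * X ^ 7 := by ring
      _ ≤ X ^ (5 + 7) := mul_pow_le_pow_of_two_le hX2 (by norm_num)
      _ = X ^ 12 := by norm_num

end Parameters

theorem exists_bisection_steps {X α : ℝ} (hX : 2 ≤ X) (hα : 1 < α) :
    ∃ K : ℕ, 24 * Real.log X < 2 ^ K * Real.log α ∧
      (K : ℝ) + 1 ≤ 16 * Real.log (2 + Real.log X / Real.log α) := by
  have hlα : 0 < Real.log α := Real.log_pos hα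
  have hlX : 0 < Real.log X := Real.log_pos (by linarith)
  set Y := Real.log X / Real.log α with hY
  have hY0 : 0 < Y := div_pos hlX hlα
  set L := Real.log (2 + Y) with hL
  have hl2 : 1 / 2 ≤ Real.log 2 := by linarith [Real.log_two_gt_d9]
  have hL2 : Real.log 2 ≤ L := Real.log_le_log (by norm_num) (by linarith)
  have hl24 : Real.log (24 * (2 + Y)) ≤ 5 * Real.log 2 + L := by
    rw [Real.log_mul (by norm_num) (by positivity)]
    have : Real.log 24 ≤ Real.log (2 ^ 5) := Real.log_le_log (by norm_num) (by norm_num)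
    rw [Real.log_pow] at this
    push_cast at this
    linarith
  have hl0 : 0 ≤ Real.log (24 * (2 + Y)) / Real.log 2 :=
    div_nonneg (Real.log_nonneg (by linarith)) (by linarith)
  -- This K makes 2^K exceed 24(2 + Y). As 24 ≤ 2^5 and log 2 ≥ 1/2, it satisfies K + 1 ≤ 7 + 2L ≤
  -- 16L.
  refine ⟨⌊Real.log (24 * (2 + Y)) / Real.log 2⌋₊ + 1, ?_, ?_⟩
  · have h1 := Nat.lt_floor_add_one (Real.log (24 * (2 + Y)) / Real.log 2)
    set K := ⌊Real.log (24 * (2 + Y)) / Real.log 2⌋₊ + 1 with hK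
    have h2 : Real.log (24 * (2 + Y)) < Real.log (2 ^ K) := by
      rw [div_lt_iff₀ (by linarith)] at h1
      rw [Real.log_pow, hK]
      push_cast
      exact h1
    have h3 : 24 * (2 + Y) < 2 ^ K :=
      (Real.log_lt_log_iff (by positivity) (by positivity)).mp h2
    have h4 : 24 * Y < 2 ^ K := by linarith
    calc 24 * Real.log X = 24 * Y * Real.log α := by rw [hY]; field_simp
      _ < 2 ^ K * Real.log α := mul_lt_mul_of_pos_right h4 hlα
  · have h1 := Nat.floor_le hl0
    push_cast
    have h2 : Real.log (24 * (2 + Y)) / Real.log 2 ≤ 5 + 2 * L := by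
      rw [div_le_iff₀ (by linarith)]
      nlinarith
    linarith

theorem exists_iterations {m d : ℕ} {c₂ ρ D ε : ℝ} (hd : 0 < d) (hc₂ : 0 < c₂)
    (hmd : (m : ℝ) ≤ c₂ * d) (hρ : 0 < ρ) (hD : 0 < D) (hε : 0 < ε) :
    ∃ T : ℕ, 216 * ρ * m * D ^ 3 / ε ≤ (T : ℝ) ^ (3 / 2 : ℝ) ∧
      (T : ℝ) ≤ (2 + 36 * c₂ ^ (2 / 3 : ℝ)) *
        (d + (d : ℝ) ^ (2 / 3 : ℝ) * (ρ * D ^ 3) ^ (2 / 3 : ℝ) * ε ^ (-(2 / 3) : ℝ)) := by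
  have hd1 : (1 : ℝ) ≤ d := by exact_mod_cast hd
  set B := 216 * ρ * m * D ^ 3 / ε with hB
  have hB0 : 0 ≤ B := by positivity
  -- Rounding up adds at most 1 ≤ d, and 36 = 216^(2/3).
  refine ⟨⌈B ^ (2 / 3 : ℝ)⌉₊, ?_, ?_⟩
  · calc B = (B ^ (2 / 3 : ℝ)) ^ (3 / 2 : ℝ) := by
          rw [← Real.rpow_mul hB0]; norm_num
      _ ≤ _ := Real.rpow_le_rpow (by positivity) (Nat.le_ceil _) (by norm_num)
  · set X := (d : ℝ) ^ (2 / 3 : ℝ) * (ρ * D ^ 3) ^ (2 / 3 : ℝ) * ε ^ (-(2 / 3) : ℝ) with hX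
    have hX0 : 0 ≤ X := by positivity
    have hle : B ≤ 216 * (c₂ * d) * (ρ * D ^ 3) * ε⁻¹ := by
      rw [hB, div_eq_mul_inv]
      have : 216 * ρ * m * D ^ 3 = 216 * (m : ℝ) * (ρ * D ^ 3) := by ring
      rw [this]
      gcongr
    have h216 : (216 : ℝ) ^ (2 / 3 : ℝ) = 36 := by
      rw [show (216 : ℝ) = 6 ^ (3 : ℝ) by norm_num, ← Real.rpow_mul (by norm_num)]
      norm_num
    have h1 : B ^ (2 / 3 : ℝ) ≤ 36 * c₂ ^ (2 / 3 : ℝ) * X := by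
      refine (Real.rpow_le_rpow hB0 hle (by norm_num)).trans_eq ?_
      rw [Real.mul_rpow (by positivity) (by positivity),
        Real.mul_rpow (by positivity) (by positivity),
        Real.mul_rpow (by positivity) (by positivity),
        Real.mul_rpow (by positivity) (by positivity), h216, hX, Real.inv_rpow hε.le,
        Real.rpow_neg hε.le]
      ring
    have h2 := (Nat.ceil_lt_add_one (by positivity : 0 ≤ B ^ (2 / 3 : ℝ))).le
    have h3 : 0 ≤ c₂ ^ (2 / 3 : ℝ) * d := by positivity
    nlinarith

/-- Because m ≥ c₁d, the snapshot cost (T/m + 1) d (N + κd²) is of order Z (N + d²), like one Newton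
step per iteration. Terms without a logarithm are absorbed by 1 ≤ 2L, and 528 = 33 · 16. -/
theorem total_cost_le {c₁ CT κ N d m T K Z L cost : ℝ} (hc₁ : 0 < c₁) (hκ : 0 ≤ κ)
    (hN : 0 ≤ N) (hd : 1 ≤ d) (hm : 0 < m) (hmd : c₁ * d ≤ m) (hT0 : 0 ≤ T) (hT : T ≤ CT * Z)
    (hdZ : d ≤ Z) (hL : 1 / 2 ≤ L) (hK : K + 1 ≤ 16 * L) (hK0 : 0 ≤ K)
    (hcost : cost ≤ T * (2 * N + (K + 1) * (33 * d ^ 2)) + (T / m + 1) * (N * d + κ * d ^ 3) +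
      (d + 1)) :
    cost ≤ (528 * CT + 2 * (CT / c₁ + 1) * (1 + κ) + 4) * (N + d ^ 2) * Z * L := by
  have hZ : 1 ≤ Z := hd.trans hdZ
  have hL0 : 0 ≤ L := by linarith
  have hCT : 0 ≤ CT * Z := hT0.trans hT
  have hCT0 : 0 ≤ CT := nonneg_of_mul_nonneg_left hCT (by linarith)
  set S := N + d ^ 2 with hS
  have hS1 : 1 ≤ S := by nlinarith
  have h1 : T * (2 * N + (K + 1) * (33 * d ^ 2)) ≤ 528 * CT * S * Z * L := by
    have h2 : 2 * N + (K + 1) * (33 * d ^ 2) ≤ 33 * (K + 1) * S := by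
      rw [hS]; nlinarith [mul_nonneg hK0 hN]
    calc T * (2 * N + (K + 1) * (33 * d ^ 2)) ≤ (CT * Z) * (33 * (16 * L) * S) := by
          refine mul_le_mul hT (h2.trans ?_) (by positivity) hCT
          gcongr
      _ = 528 * CT * S * Z * L := by ring
  have h3 : (T / m + 1) * d ≤ (CT / c₁ + 1) * Z := by
    have h4 : T / m * d ≤ CT * Z / c₁ := by
      rw [div_mul_eq_mul_div, div_le_div_iff₀ hm hc₁]
      calc T * d * c₁ = T * (c₁ * d) := by ring
        _ ≤ CT * Z * m := mul_le_mul hT hmd (by positivity) hCT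
    have h5 : (CT / c₁ + 1) * Z = CT * Z / c₁ + Z := by ring
    rw [h5, add_mul, one_mul]
    exact add_le_add h4 hdZ
  have h6 : (T / m + 1) * (N * d + κ * d ^ 3) ≤ 2 * (CT / c₁ + 1) * (1 + κ) * S * Z * L := by
    have h7 : N + κ * d ^ 2 ≤ (1 + κ) * S := by
      rw [hS]; nlinarith [mul_nonneg hκ hN, sq_nonneg d]
    have h8 : 0 ≤ (CT / c₁ + 1) * Z * ((1 + κ) * S) := by positivity
    calc (T / m + 1) * (N * d + κ * d ^ 3) = ((T / m + 1) * d) * (N + κ * d ^ 2) := by ring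
      _ ≤ ((CT / c₁ + 1) * Z) * ((1 + κ) * S) :=
        mul_le_mul h3 h7 (by positivity) (by positivity)
      _ ≤ ((CT / c₁ + 1) * Z) * ((1 + κ) * S) * (2 * L) :=
        le_mul_of_one_le_right h8 (by linarith)
      _ = _ := by ring
  have h9 : d + 1 ≤ 4 * S * Z * L := by
    have h10 : d + 1 ≤ 2 * S := by rw [hS]; nlinarith
    calc d + 1 ≤ 2 * S * 1 * 1 := by linarith
      _ ≤ 2 * S * Z * (2 * L) := by gcongr; linarith
      _ = 4 * S * Z * L := by ring
  calc cost ≤ _ := hcost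
    _ ≤ 528 * CT * S * Z * L + 2 * (CT / c₁ + 1) * (1 + κ) * S * Z * L + 4 * S * Z * L :=
      add_le_add (add_le_add h1 h6) h9
    _ = _ := by ring

/-! ### Assembly -/

/-- The output of LEN is an approximate saddle point. -/
theorem len_isEpsSaddlePoint {dx dy m N κ T K : ℕ} {ρ D ε η₀ α : ℝ} (hm : 0 < m) (hρ : 0 < ρ)
    (hD : 0 < D) (hε : 0 < ε) (hη₀ : 0 < η₀) (hα : 1 < α) (hα2 : α ≤ 2)
    (hT : 216 * ρ * m * D ^ 3 / ε ≤ (T : ℝ) ^ (3 / 2 : ℝ))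
    (hK : 24 * Real.log (problemSize m ρ D ε η₀) < 2 ^ K * Real.log α)
    {f : Vec dx → Vec dy → ℝ} {z₀ zs : Vec (dx + dy)} (S : SchurRoutine (dx + dy))
    (hf : ConvexConcave f ρ) (hs : IsSaddlePoint f (xPart zs) (yPart zs)) (hz₀ : ‖z₀ - zs‖ ≤ D) :
    IsEpsSaddlePoint f zs z₀ (3 * D) ε
      (len ⟨gdaField f, N, S, κ⟩ z₀ T m (3 * ρ * m) α η₀ K).val := by
  have hm' : (0 : ℝ) < m := by exact_mod_cast hm
  have hM : 0 < 3 * ρ * m := by positivity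
  have hF := hf.differentiable_gdaField
  have hlip := hf.fderiv_gdaField_lipschitz
  have hzs := hf.inner_gdaField_nonneg hs
  have hA := inner_fderiv_nonneg_of_monotone hf.gdaField_monotone hF
  -- The loop starts from the run of length 0. The zero matrices of the initial state are harmless,
  -- since iteration 0 takes a snapshot.
  obtain ⟨T', z, h, η, h0, H, hout⟩ := lenLoop_outcome ⟨gdaField f, N, S, κ⟩ hA (m := m) hM hα hη₀
    K T 0 ⟨z₀, 0, 0, 0, 0⟩ (fun _ => z₀) (fun _ => 0) (fun _ => 0)
    ⟨by simp, by simp, by simp, by simp, by simp⟩ rfl (by simp) (by simp) (by simp)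
  simp only at h0 H
  subst h0
  rcases hout with ⟨rfl, hval⟩ | hhalt
  · rw [len, hval]
    rw [zero_add] at H ⊢
    exact isEpsSaddlePoint_of_run hf hρ hs hD hε hm hα hα2 H hz₀ hT
  · rw [len]
    simp only at hhalt
    generalize (lenLoop ⟨gdaField f, N, S, κ⟩ m (3 * ρ * m) α η₀ K T 0 ⟨z 0, 0, 0, 0, 0⟩).val = w
      at hhalt ⊢
    set c := z (T' - T' % m)
    have hzT : ‖z T' - zs‖ ≤ D := H.norm_sub_le hm hρ hF hlip hzs hz₀ le_rfl
    have hcT : ‖c - zs‖ ≤ D := H.norm_sub_le hm hρ hF hlip hzs hz₀ (Nat.sub_le _ _)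
    have hN := fun η hη => newtonStep_jacobian S (hA c) (z T') (gdaField f (z T')) (η := η) hη
    obtain ⟨hw, hcase⟩ := of_search_eq_halt (hA c) hN hM hα hη₀ hhalt
    have hnewton := hN η₀ hη₀
    rw [← hw] at hnewton
    have hshort : ‖w - z T'‖ ≤ D ∧ ‖w - z T'‖ * (7 * D * (1 / η₀ + 3 * ρ * D)) ≤ ε := by
      rcases hcase with h0 | ⟨hpos, hlog⟩
      · rw [h0, zero_mul]
        exact ⟨hD.le, hε.le⟩
      · have hup := norm_newton_direction_le hρ.le hF hlip hf.gdaField_monotone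
          (hf.gdaField_saddle hs) hzT hcT hη₀ hnewton
        rw [norm_sub_rev] at hup
        exact short_step_of_log_le hm hρ hD hε hη₀ hα hα2 hpos hup hK hlog
    exact isEpsSaddlePoint_of_short_step hf hρ.le hz₀ hη₀ hzT hcT hnewton hshort.1 hshort.2

end LEN

theorem theorem3 (c₁ c₂ : ℝ) (hc₁ : 0 < c₁) (hc₂ : 0 < c₂) (κ : ℕ) :
    ∃ C : ℝ, 0 < C ∧
      ∀ (dx dy m N : ℕ) (ρ D ε η₀ α : ℝ),
        0 < m → c₁ * ((dx + dy : ℕ) : ℝ) ≤ m → (m : ℝ) ≤ c₂ * ((dx + dy : ℕ) : ℝ) →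
        0 < ρ → 0 < D → 0 < ε → 0 < η₀ → 1 < α → α ≤ 2 →
        ∃ T K : ℕ,
          ∀ (f : LEN.Vec dx → LEN.Vec dy → ℝ) (z₀ zs : LEN.Vec (dx + dy))
            (S : LEN.SchurRoutine (dx + dy)),
            LEN.ConvexConcave f ρ →
            LEN.IsSaddlePoint f (LEN.xPart zs) (LEN.yPart zs) →
            ‖z₀ - zs‖ ≤ D →
            LEN.IsEpsSaddlePoint f zs z₀ (3 * D) ε
              (LEN.len ⟨LEN.gdaField f, N, S, κ⟩ z₀ T m (3 * ρ * m) α η₀ K).val ∧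
            ((LEN.len ⟨LEN.gdaField f, N, S, κ⟩ z₀ T m (3 * ρ * m) α η₀ K).cost : ℝ) ≤
              C * ((N : ℝ) + ((dx + dy : ℕ) : ℝ) ^ 2) *
                (((dx + dy : ℕ) : ℝ) +
                  ((dx + dy : ℕ) : ℝ) ^ (2 / 3 : ℝ) * (ρ * D ^ 3) ^ (2 / 3 : ℝ) *
                    ε ^ (-(2 / 3) : ℝ)) *
                LEN.logFactor m ρ D ε η₀ α := by
  set CT : ℝ := 2 + 36 * c₂ ^ (2 / 3 : ℝ)
  refine ⟨528 * CT + 2 * (CT / c₁ + 1) * (1 + κ) + 4, by positivity, ?_⟩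
  intro dx dy m N ρ D ε η₀ α hm hmd hmd' hρ hD hε hη₀ hα hα2
  have hm' : (0 : ℝ) < m := by exact_mod_cast hm
  have hd : 0 < dx + dy := by
    rcases Nat.eq_zero_or_pos (dx + dy) with h | h
    · rw [h, Nat.cast_zero, mul_zero] at hmd'
      linarith
    · exact h
  have hX := LEN.le_problemSize (m := m) hρ hD hε hη₀
  obtain ⟨T, hT, hTle⟩ := LEN.exists_iterations hd hc₂ hmd' hρ hD hε
  obtain ⟨K, hK, hKle⟩ := LEN.exists_bisection_steps hX.1 hα
  refine ⟨T, K, fun f z₀ zs S hf hs hz₀ =>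
    ⟨LEN.len_isEpsSaddlePoint hm hρ hD hε hη₀ hα hα2 hT hK S hf hs hz₀, ?_⟩⟩
  have hL : 1 / 2 ≤ LEN.logFactor m ρ D ε η₀ α := by
    have h1 : Real.log 2 ≤ LEN.logFactor m ρ D ε η₀ α := by
      refine Real.log_le_log (by norm_num) (le_add_of_nonneg_right (div_nonneg ?_ ?_))
      · exact Real.log_nonneg (by have := hX.1; unfold LEN.problemSize at this; linarith)
      · exact Real.log_nonneg hα.le
    linarith [Real.log_two_gt_d9]
  exact LEN.total_cost_le hc₁ (Nat.cast_nonneg κ) (Nat.cast_nonneg N) (by exact_mod_cast hd) hm'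
    hmd (Nat.cast_nonneg T) hTle (le_add_of_nonneg_right (by positivity)) hL hKle
    (Nat.cast_nonneg K) (LEN.len_cost_le hd _ z₀ hm _ α η₀ T K)
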